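/- Fix an integer $K\ge 1$ and an alphabet $\{0,\dots,q-1\}$. Let $\mathbb G(N,M)$ be the random directed $K$-uniform hypergraph on $[N]=\{1,\dots,N\}$ with $M$ hyperedges $e_1,\dots,e_M$ chosen independently and uniformly at random, with replacement, from $[N]^K$. Given a node potential $h:\{0,\dots,q-1\}\to\mathbb R$ and (possibly random) edge potentials $H_{e_j}:\{0,\dots,q-1\}^K\to\mathbb R\cup\{-\infty\}$, put $$H(x)=\sum_{i=1}^N h(x_i)+\sum_{j=1}^M H_{e_j}(x_{e_j}),\qquad H(\mathbb G(N,M))=\max_{x\in\{0,\dots,q-1\}^N}H(x),$$ where $x_e=(x_{i_1},\dots,x_{i_K})$ for $e=(i_1,\dots,i_K)$. Consider the following six models. * Independent set: $K=q=2$, $h(1)=1$, $h(0)=0$, $H_e(1,1)=-\infty$ and $H_e=0$ otherwise. * MAX-CUT: $K=q=2$, $h=0$, $H_e(s,t)=\mathbf 1\{s\ne t\}$. * Anti-ferromagnetic Ising model with parameters $\beta>0$, $B\in\mathbb R$: $K=q=2$, $h(0)=-B$, $h(1)=B$, $H_e(s,t)=\beta$ if $s\neq t$ and $-\beta$ if $s=t$.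 * $q$-Coloring ($q\ge1$): $K=2$, $h=0$, $H_e(s,t)=\mathbf 1\{s\ne t\}$. * K-SAT ($K\ge 2$): $q=2$, $h=0$; each hyperedge $e_j$ carries an independent uniformly random $a\in\{0,1\}^K$, and $H_{e_j}(a)=0$, $H_{e_j}(y)=1$ for $y\ne a$. * NAE-K-SAT ($K\ge 2$): as K-SAT, but $H_{e_j}(a)=H_{e_j}(1-a_1,\dots,1-a_K)=0$ and $H_{e_j}(y)=1$ for all other $y$. **Theorem.** For each of these models there is a function $H:(0,\infty)\to\mathbb R$ (depending on the model and its parameters) such that for every $c>0$, $N^{-1}H(\mathbb G(N,\lfloor cN\rfloor))$ converges to $H(c)$ in probability as $N\to\infty$. The function $H$ is Lipschitz continuous, with constant $\beta$ for the Ising model and constant $1$ for the other five models. It is non-decreasing for MAX-CUT, Coloring, K-SAT and NAE-K-SAT, and non-increasing for Independent set. Moreover, let $p(N,M)=\mathbb P(H(\mathbb G(N,M))=M)$ be the probability of satisfiability. For $q$-Coloring with $q\ge 2$, K-SAT and NAE-K-SAT, and for every $c>0$, $p(N,\lfloor cN\rfloor)>0$ for all large $N$ and the finite limit $\lim_{N\to\infty}N^{-1}\log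 p(N,\lfloor cN\rfloor)$ exists. -/

import Mathlib

open Set Filter Topology MeasureTheory ProbabilityTheory

namespace DilutedSpin

/-- A `K`-uniform model over the alphabet `{0, …, q-1}`: a node potential, and an edge potential
with values in `ℝ ∪ {-∞}` which may depend on a mark `a ∈ {0,1}^K` attached to the hyperedge
(the models whose edge potentials are not random ignore the mark). -/
structure Model (K q : ℕ) where
  /-- the potential of a node -/
  node : Fin q → ℝ
  /-- the potential of a hyperedge with a given mark -/
  edge : (Fin K → Fin 2) → (Fin K → Fin q) → EReal

/-- Independent set. -/
noncomputable def independentSet : Model 2 2 where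
  node s := if s = 1 then 1 else 0
  edge _ y := if y 0 = 1 ∧ y 1 = 1 then ⊥ else 0

/-- MAX-CUT. -/
noncomputable def maxCut : Model 2 2 where
  node _ := 0
  edge _ y := if y 0 = y 1 then 0 else 1

/-- The anti-ferromagnetic Ising model with interaction `β` and magnetic field `B`. -/
noncomputable def ising (β B : ℝ) : Model 2 2 where
  node s := if s = 0 then -B else B
  edge _ y := if y 0 = y 1 then ((-β : ℝ) : EReal) else ((β : ℝ) : EReal)

/-- `q`-coloring. -/
noncomputable def coloring (q : ℕ) : Model 2 q where
  node _ := 0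
  edge _ y := if y 0 = y 1 then 0 else 1

/-- Random K-SAT: the assignment equal to the mark is the only one that violates the clause. -/
noncomputable def kSat (K : ℕ) : Model K 2 where
  node _ := 0
  edge a y := if y = a then 0 else 1

/-- Random NAE-K-SAT: the assignments equal to the mark or to its complement violate the clause. -/
noncomputable def naeKSat (K : ℕ) : Model K 2 where
  node _ := 0
  edge a y := if y = a ∨ y = (fun j => 1 - a j) then 0 else 1

/-- A list of `M` directed hyperedges in `[N]^K` (nodes and hyperedges may repeat), each with a mark
in `{0,1}^K`. -/
abbrev MarkedHypergraph (K N M : ℕ) : Type :=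
  Fin M → (Fin K → Fin N) × (Fin K → Fin 2)

/-- The law of `𝔾(N, M)` together with the marks: the uniform distribution on all lists, so that the
`M` hyperedges are independent and uniform on `[N]^K` (drawn with replacement), and the marks are
independent and uniform on `{0,1}^K`. -/
noncomputable def law (K N M : ℕ) : Measure (MarkedHypergraph K N M) :=
  uniformOn Set.univ

/-- The value `H(x)` of an assignment `x`. -/
noncomputable def energy {K q N M : ℕ} (m : Model K q) (G : MarkedHypergraph K N M)
    (x : Fin N → Fin q) : EReal :=
  (∑ i : Fin N, (m.node (x i) : EReal)) + ∑ j : Fin M, m.edge (G j).2 (fun k => x ((G j).1 k))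

/-- The optimal value `H(𝔾)`. -/
noncomputable def groundState {K q N M : ℕ} (m : Model K q) (G : MarkedHypergraph K N M) : EReal :=
  ⨆ x : Fin N → Fin q, energy m G x

/-- `N⁻¹ H(𝔾(N, ⌊cN⌋))` converges to `h` in probability as `N → ∞`. -/
def GroundStateLimit {K q : ℕ} (m : Model K q) (c h : ℝ) : Prop :=
  ∀ ε : ℝ, 0 < ε →
    Tendsto (fun N : ℕ => law K N ⌊c * N⌋₊
        {G | ENNReal.ofReal ε < (groundState m G / (N : EReal) - (h : EReal)).abs})
      atTop (𝓝 0)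

/-- `p(N, M)`: the probability that `𝔾(N, M)` is satisfiable, that is, `H(𝔾(N, M)) = M`. -/
noncomputable def satProb {K q : ℕ} (m : Model K q) (N M : ℕ) : ℝ :=
  (law K N M).real {G | groundState m G = (M : EReal)}

/-- `p(N, ⌊cN⌋)` is positive for all large `N`, and `N⁻¹ log p(N, ⌊cN⌋)` converges to `r`. -/
def SatRateLimit {K q : ℕ} (m : Model K q) (c r : ℝ) : Prop :=
  (∀ᶠ N : ℕ in atTop, 0 < satProb m N ⌊c * N⌋₊) ∧
    Tendsto (fun N : ℕ => Real.log (satProb m N ⌊c * N⌋₊) / (N : ℝ)) atTop (𝓝 r)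

end DilutedSpin

/-!
The proof is the interpolation method in a form that treats all six models at once.

Every model is a `PenaltyModel`: a hyperedge contributes `top` when its assignment is good and
`top - cost` when it is bad. For independent sets the potential `-∞` may be replaced by `-1`, since
deleting a node from each violated edge costs nothing (`exists_independent_value_ge`).

Cut the nodes into blocks and compare a uniform hyperedge with a local one, which lies in a block
chosen with probability proportional to its size. Given the other hyperedges, the loss in the
optimal value caused by a new hyperedge exceeds `t < cost` exactly when all assignments that are
optimal up to `t` are bad on it (`PenaltyModel.lt_loss_iff`). For any nonempty set of assignments,
the number of marks for which all of them are bad on a tuple of `K` nodes is a sum of `K`-fold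
tensor powers of nonnegative functions on the nodes (`PenaltyModel.TensorConvex`): for pair models
these are the indicators of the classes of nodes that always receive equal values, and similarly in
the other models. Convexity of `s ↦ s ^ K` then says that a local hyperedge is at least as likely to
cause the loss. Integrating over `t` gives the comparison of mean optimal values
(`PenaltyModel.TensorConvex.sum_best_le`); applied to the set of all satisfying assignments the same
inequality compares the probabilities of satisfiability.

Replacing the hyperedges one at a time (`listMean_map_le`) decouples the blocks. Hence both the mean
optimal value `Λ(N, M)` and, by Jensen's inequality, `Λ(N, M) = log p(N, M)` are at least the mean
of `∑ᵢ Λ(nᵢ, Mᵢ)`, where `nᵢ` are the block sizes and the `Mᵢ` are multinomial. The `Mᵢ` deviate from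
their means by `O(√nᵢ)` on average, and one hyperedge changes `Λ(n, ·)` by `O(1)`, respectively
`O(log n)`. So with blocks of a fixed large size `N⁻¹ Λ(N, ⌊c N⌋)` converges
(`BlockSuperadditive.exists_tendsto`). The optimal value has variance `O(M)` by the Efron–Stein
bound, which gives convergence in probability; the Lipschitz constant and the monotonicity of the
limit come from the effect of a single hyperedge.
-/

namespace DilutedSpin

/-! ### Means over lists of independent letters -/

/-- The mean of `F` over lists of `M` independent letters, each drawn with weights `w`.
The recursion on the first letter makes the interpolation a plain induction on `M`. -/
def listMean {α : Type*} [Fintype α] (w : α → ℝ) : ℕ → (List α → ℝ) → ℝ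
  | 0, F => F []
  | M + 1, F => ∑ a, w a * listMean w M (fun L => F (a :: L))

section ListMean

variable {α α' : Type*} [Fintype α] [Fintype α'] {w : α → ℝ}

theorem listMean_mono (hw : ∀ a, 0 ≤ w a) {M : ℕ} {F G : List α → ℝ} (h : ∀ L, F L ≤ G L) :
    listMean w M F ≤ listMean w M G := by
  induction M generalizing F G with
  | zero => exact h []
  | succ M ih =>
    exact Finset.sum_le_sum fun a _ => mul_le_mul_of_nonneg_left (ih fun L => h _) (hw a)

theorem listMean_const (hw : ∑ a, w a = 1) (M : ℕ) (r : ℝ) : listMean w M (fun _ => r) = r := by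
  induction M with
  | zero => rfl
  | succ M ih => simp [listMean, ih, ← Finset.sum_mul, hw]

theorem listMean_add (M : ℕ) (F G : List α → ℝ) :
    listMean w M (fun L => F L + G L) = listMean w M F + listMean w M G := by
  induction M generalizing F G with
  | zero => rfl
  | succ M ih => simp [listMean, ih, mul_add, Finset.sum_add_distrib]

theorem listMean_mul_left (M : ℕ) (r : ℝ) (F : List α → ℝ) :
    listMean w M (fun L => r * F L) = r * listMean w M F := by
  induction M generalizing F with
  | zero => rfl
  | succ M ih =>
    simp only [listMean, ih, Finset.mul_sum]
    exact Finset.sum_congr rfl fun a _ => by ring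

theorem listMean_sub (M : ℕ) (F G : List α → ℝ) :
    listMean w M (fun L => F L - G L) = listMean w M F - listMean w M G := by
  have h := listMean_add (w := w) M F (fun L => (-1) * G L)
  rw [listMean_mul_left] at h
  simpa [sub_eq_add_neg] using h

theorem listMean_sum {ι : Type*} (s : Finset ι) (M : ℕ) (F : ι → List α → ℝ) :
    listMean w M (fun L => ∑ i ∈ s, F i L) = ∑ i ∈ s, listMean w M (F i) := by
  classical
  induction s using Finset.induction_on with
  | empty =>
    have := listMean_mul_left (w := w) M 0 (fun _ => 0)
    simpa using this
  | insert i s hi ih => simp [Finset.sum_insert hi, listMean_add, ih]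

theorem listMean_succ (M : ℕ) (F : List α → ℝ) :
    listMean w (M + 1) F = listMean w M (fun L => ∑ a, w a * F (a :: L)) := by
  simp [listMean, listMean_sum, listMean_mul_left]

/-- Comparison of two letter distributions: if replacing any single letter of the first kind by a
letter of the second kind does not increase the mean of `F`, then neither does replacing all. -/
theorem listMean_map_le {w' : α' → ℝ} (hw : ∀ a, 0 ≤ w a) (hw' : ∀ a, 0 ≤ w' a) (φ : α' → α)
    {F : List α → ℝ}
    (h : ∀ L₁ L₂, ∑ a, w' a * F (L₁ ++ φ a :: L₂) ≤ ∑ a, w a * F (L₁ ++ a :: L₂)) (M : ℕ) :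
    listMean w' M (fun L => F (L.map φ)) ≤ listMean w M F := by
  induction M generalizing F with
  | zero => exact le_rfl
  | succ M ih =>
    calc listMean w' (M + 1) (fun L => F (L.map φ))
        = listMean w' M (fun L => ∑ a, w' a * F (φ a :: L.map φ)) := by
          simp [listMean_succ]
      _ ≤ listMean w' M (fun L => ∑ a, w a * F (a :: L.map φ)) :=
          listMean_mono hw' fun L => by simpa using h [] (L.map φ)
      _ = ∑ a, w a * listMean w' M (fun L => F (a :: L.map φ)) := by
          simp [listMean_sum, listMean_mul_left]
      _ ≤ ∑ a, w a * listMean w M (fun L => F (a :: L)) :=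
          Finset.sum_le_sum fun a _ => mul_le_mul_of_nonneg_left
            (ih (F := fun L => F (a :: L)) fun L₁ L₂ => by simpa using h (a :: L₁) L₂) (hw a)

theorem listMean_equiv (φ : α' ≃ α) (M : ℕ) (F : List α → ℝ) :
    listMean (fun a => w (φ a)) M (fun L => F (L.map φ)) = listMean w M F := by
  induction M generalizing F with
  | zero => rfl
  | succ M ih =>
    simp only [listMean, List.map_cons]
    rw [← φ.sum_comp (fun a => w a * listMean w M (fun L => F (a :: L)))]
    exact Finset.sum_congr rfl fun a _ => by rw [ih (fun L => F (φ a :: L))]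

/-- The Efron–Stein bound, for a function that changes by at most `b` when one letter changes. -/
theorem listMean_sq_le (hw : ∀ a, 0 ≤ w a) (hw1 : ∑ a, w a = 1) {b : ℝ} {F : List α → ℝ}
    (h : ∀ L₁ L₂ a a', |F (L₁ ++ a :: L₂) - F (L₁ ++ a' :: L₂)| ≤ b) (M : ℕ) :
    listMean w M (fun L => F L ^ 2) ≤ (listMean w M F) ^ 2 + M * b ^ 2 := by
  induction M generalizing F with
  | zero => simp [listMean]
  | succ M ih =>
    set g : α → ℝ := fun a => listMean w M (fun L => F (a :: L)) with hg
    have hgb : ∀ a a', |g a - g a'| ≤ b := by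
      intro a a'
      rw [hg]
      simp only
      rw [← listMean_sub, abs_le]
      constructor
      · rw [← listMean_const (w := w) hw1 M (-b)]
        exact listMean_mono hw fun L => (abs_le.1 (h [] L a a')).1
      · rw [← listMean_const (w := w) hw1 M b]
        exact listMean_mono hw fun L => (abs_le.1 (h [] L a a')).2
    set μ := ∑ a, w a * g a with hμ
    have hdev : ∀ a, |g a - μ| ≤ b := by
      intro a
      have : g a - μ = ∑ a', w a' * (g a - g a') := by
        simp [mul_sub, Finset.sum_sub_distrib, ← Finset.sum_mul, hw1, hμ]
      rw [this]
      calc |∑ a', w a' * (g a - g a')| ≤ ∑ a', |w a' * (g a - g a')| :=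
            Finset.abs_sum_le_sum_abs _ _
        _ ≤ ∑ a', w a' * b := Finset.sum_le_sum fun a' _ => by
            rw [abs_mul, abs_of_nonneg (hw a')]
            exact mul_le_mul_of_nonneg_left (hgb a a') (hw a')
        _ = b := by rw [← Finset.sum_mul, hw1, one_mul]
    have hvar : ∑ a, w a * g a ^ 2 ≤ μ ^ 2 + b ^ 2 := by
      have h1 : ∑ a, w a * (g a - μ) ^ 2 = ∑ a, w a * g a ^ 2 - μ ^ 2 := by
        have : ∀ a, w a * (g a - μ) ^ 2 = w a * g a ^ 2 - 2 * μ * (w a * g a) + μ ^ 2 * w a :=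
          fun a => by ring
        simp only [this, Finset.sum_add_distrib, Finset.sum_sub_distrib, ← Finset.mul_sum, hw1,
          ← hμ]
        ring
      have h2 : ∑ a, w a * (g a - μ) ^ 2 ≤ ∑ a, w a * b ^ 2 :=
        Finset.sum_le_sum fun a _ => mul_le_mul_of_nonneg_left
          (sq_le_sq' (abs_le.1 (hdev a)).1 (abs_le.1 (hdev a)).2) (hw a)
      rw [← Finset.sum_mul, hw1] at h2
      linarith
    calc listMean w (M + 1) (fun L => F L ^ 2)
        = ∑ a, w a * listMean w M (fun L => F (a :: L) ^ 2) := rfl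
      _ ≤ ∑ a, w a * (g a ^ 2 + M * b ^ 2) :=
          Finset.sum_le_sum fun a _ => mul_le_mul_of_nonneg_left
            (ih fun L₁ L₂ c c' => by simpa using h (a :: L₁) L₂ c c') (hw a)
      _ = ∑ a, w a * g a ^ 2 + M * b ^ 2 := by
          simp [mul_add, Finset.sum_add_distrib, ← Finset.sum_mul, hw1]
      _ ≤ μ ^ 2 + (M + 1 : ℕ) * b ^ 2 := by push_cast; linarith

theorem listMean_sq_sub_mean (hw1 : ∑ a, w a = 1) (M : ℕ) (F : List α → ℝ) :
    listMean w M (fun L => (F L - listMean w M F) ^ 2)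
      = listMean w M (fun L => F L ^ 2) - (listMean w M F) ^ 2 := by
  set μ := listMean w M F with hμ
  have : (fun L => (F L - μ) ^ 2) = fun L => (F L ^ 2 - (2 * μ) * F L) + μ ^ 2 := by
    funext L; ring
  rw [this, listMean_add, listMean_sub, listMean_mul_left, listMean_const hw1, ← hμ]
  ring

/-- The second moment of the centred number of occurrences of a letter, shifted by `s`; the shift
is what the induction on `M` needs. -/
theorem listMean_count_sq [DecidableEq α] (hw1 : ∑ a, w a = 1) (b : α) (M : ℕ) (s : ℝ) :
    listMean w M (fun L => ((L.count b : ℝ) - M * w b + s) ^ 2)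
      = M * (w b * (1 - w b)) + s ^ 2 := by
  induction M generalizing s with
  | zero => simp [listMean]
  | succ M ih =>
    have key : ∀ a, listMean w M
        (fun L => (((a :: L).count b : ℝ) - (M + 1 : ℕ) * w b + s) ^ 2)
          = M * (w b * (1 - w b)) + ((if a = b then 1 else 0) - w b + s) ^ 2 := by
      intro a
      rw [← ih]
      congr 1
      funext L
      rw [List.count_cons]
      by_cases hab : a = b
      · simp [hab]; ring
      · simp [hab]; ring
    simp only [listMean, key]
    have h2 : ∀ a, w a * (M * (w b * (1 - w b)) + ((if a = b then 1 else 0) - w b + s) ^ 2)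
        = (M * (w b * (1 - w b)) + (s - w b) ^ 2) * w a
          + (if a = b then w a * (1 + 2 * (s - w b)) else 0) := by
      intro a
      split_ifs <;> ring
    simp only [h2, Finset.sum_add_distrib, ← Finset.mul_sum, hw1, Finset.sum_ite_eq',
      Finset.mem_univ, if_true]
    push_cast
    ring

theorem listMean_abs_count_sub_le [DecidableEq α] (hw : ∀ a, 0 ≤ w a) (hw1 : ∑ a, w a = 1)
    (b : α) (M : ℕ) :
    listMean w M (fun L => |(L.count b : ℝ) - M * w b|) ≤ √(M * w b) := by
  apply Real.le_sqrt_of_sq_le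
  have h1 := listMean_sq_sub_mean hw1 M (fun L : List α => |(L.count b : ℝ) - M * w b|)
  have h2 : 0 ≤ listMean w M (fun L => (|(L.count b : ℝ) - M * w b| -
      listMean w M (fun L => |(L.count b : ℝ) - M * w b|)) ^ 2) := by
    rw [← listMean_const (w := w) hw1 M 0]
    exact listMean_mono hw fun L => sq_nonneg _
  have h3 := listMean_count_sq hw1 b M 0
  simp only [add_zero] at h3
  simp only [sq_abs, h3] at h1
  have : (M : ℝ) * (w b * (1 - w b)) ≤ M * w b :=
    mul_le_mul_of_nonneg_left (by nlinarith [sq_nonneg (w b)]) (Nat.cast_nonneg M)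
  nlinarith

/-- With equal weights, `listMean` is the average over all `M`-tuples. -/
theorem listMean_uniform (M : ℕ) (F : List α → ℝ) :
    listMean (fun _ : α => ((Fintype.card α : ℝ))⁻¹) M F
      = ((Fintype.card α : ℝ) ^ M)⁻¹ * ∑ G : Fin M → α, F (List.ofFn G) := by
  induction M generalizing F with
  | zero => simp [listMean]
  | succ M ih =>
    simp only [listMean, ih]
    rw [← (Fin.consEquiv fun _ : Fin (M + 1) => α).sum_comp, Fintype.sum_prod_type]
    simp only [Fin.consEquiv, Equiv.coe_fn_mk, List.ofFn_cons, Finset.mul_sum]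
    exact Finset.sum_congr rfl fun a _ => Finset.sum_congr rfl fun G _ => by
      rw [pow_succ, mul_inv]; ring

/-- Jensen's inequality for the logarithm of a positive function, whose mean is again positive. -/
theorem listMean_log_le (hw : ∀ a, 0 ≤ w a) (hw1 : ∑ a, w a = 1) (M : ℕ) {F : List α → ℝ}
    (hF : ∀ L, 0 < F L) :
    listMean w M (fun L => Real.log (F L)) ≤ Real.log (listMean w M F) ∧ 0 < listMean w M F := by
  induction M generalizing F with
  | zero => exact ⟨le_rfl, hF _⟩
  | succ M ih =>
    have h := fun a => ih (F := fun L => F (a :: L)) fun L => hF _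
    have hpos : 0 < listMean w (M + 1) F := by
      have hne : ∃ a, 0 < w a := by
        by_contra! hcon
        have : ∑ a, w a ≤ 0 := Finset.sum_nonpos fun a _ => hcon a
        linarith
      obtain ⟨a, ha⟩ := hne
      exact Finset.sum_pos' (fun a _ => mul_nonneg (hw a) (h a).2.le)
        ⟨a, Finset.mem_univ a, mul_pos ha (h a).2⟩
    refine ⟨?_, hpos⟩
    calc listMean w (M + 1) (fun L => Real.log (F L))
        ≤ ∑ a, w a * Real.log (listMean w M fun L => F (a :: L)) :=
          Finset.sum_le_sum fun a _ => mul_le_mul_of_nonneg_left (h a).1 (hw a)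
      _ ≤ Real.log (∑ a, w a * listMean w M fun L => F (a :: L)) := by
          have := strictConcaveOn_log_Ioi.concaveOn.le_map_sum (t := Finset.univ) (w := w)
            (p := fun a => listMean w M fun L => F (a :: L)) (fun a _ => hw a) hw1
            (fun a _ => (h a).2)
          simpa using this

end ListMean

/-! ### Splitting a list into its blocks -/

section Blocks

variable {β : Type*} [DecidableEq β] {α : β → Type*}

/-- The letters of `L` that lie in block `b`, in order. -/
def blockPart (b : β) : List (Σ b, α b) → List (α b)
  | [] => []
  | ⟨b', a⟩ :: L => if h : b' = b then (h ▸ a) :: blockPart b L else blockPart b L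

theorem blockPart_cons_self (b : β) (a : α b) (L : List (Σ b, α b)) :
    blockPart b (⟨b, a⟩ :: L) = a :: blockPart b L := by simp [blockPart]

theorem blockPart_cons_ne {b b' : β} (h : b' ≠ b) (a : α b') (L : List (Σ b, α b)) :
    blockPart b (⟨b', a⟩ :: L) = blockPart b L := by simp [blockPart, h]

variable [Fintype β] [∀ b, Fintype (α b)]

/-- Given the block labels, the letters in different blocks are independent. -/
theorem listMean_prod_blockPart (ρ : β → ℝ) (u : ∀ b, α b → ℝ) (M : ℕ)
    (F : ∀ b, List (α b) → ℝ) :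
    listMean (fun s : Σ b, α b => ρ s.1 * u s.1 s.2) M (fun L => ∏ b, F b (blockPart b L))
      = listMean ρ M (fun l => ∏ b, listMean (u b) (l.count b) (F b)) := by
  induction M generalizing F with
  | zero => simp [listMean, blockPart]
  | succ M ih =>
    simp only [listMean, Fintype.sum_sigma]
    refine Finset.sum_congr rfl fun b₀ _ => ?_
    have step : ∀ a : α b₀, listMean (fun s : Σ b, α b => ρ s.1 * u s.1 s.2) M
        (fun L => ∏ b, F b (blockPart b (⟨b₀, a⟩ :: L)))
          = listMean ρ M (fun l => ∏ b, listMean (u b) (l.count b)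
              (Function.update F b₀ (fun L => F b₀ (a :: L)) b)) := by
      intro a
      rw [← ih]
      congr 1
      funext L
      refine Finset.prod_congr rfl fun b _ => ?_
      by_cases hb : b = b₀
      · subst hb; simp [blockPart_cons_self]
      · rw [blockPart_cons_ne (Ne.symm hb), Function.update_of_ne hb]
    simp only [step, mul_assoc, ← Finset.mul_sum]
    congr 1
    simp only [← listMean_mul_left, ← listMean_sum]
    congr 1
    funext l
    have hsplit : ∀ G : β → ℝ, ∏ b, G b = G b₀ * ∏ b ∈ Finset.univ.erase b₀, G b := fun G =>
      (Finset.mul_prod_erase _ _ (Finset.mem_univ b₀)).symm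
    rw [hsplit fun b => listMean (u b) ((b₀ :: l).count b) (F b), List.count_cons_self]
    simp only [listMean, Finset.sum_mul]
    refine Finset.sum_congr rfl fun a _ => ?_
    rw [hsplit, Function.update_self, mul_assoc]
    congr 2
    refine Finset.prod_congr rfl fun b hb => ?_
    rw [Function.update_of_ne (Finset.ne_of_mem_erase hb),
      List.count_cons_of_ne (Finset.ne_of_mem_erase hb).symm]

theorem listMean_sum_blockPart {ρ : β → ℝ} {u : ∀ b, α b → ℝ}
    (hu : ∀ b, ∑ a, u b a = 1) (M : ℕ) (F : ∀ b, List (α b) → ℝ) :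
    listMean (fun s : Σ b, α b => ρ s.1 * u s.1 s.2) M (fun L => ∑ b, F b (blockPart b L))
      = listMean ρ M (fun l => ∑ b, listMean (u b) (l.count b) (F b)) := by
  rw [listMean_sum, listMean_sum]
  refine Finset.sum_congr rfl fun b _ => ?_
  have h := listMean_prod_blockPart ρ u M (Function.update (fun _ _ => 1) b (F b))
  have h1 : ∀ L : List (Σ b, α b), ∏ b', (Function.update (fun _ _ => (1 : ℝ)) b (F b) :
      ∀ b, List (α b) → ℝ) b' (blockPart b' L) = F b (blockPart b L) := by
    intro L
    rw [Finset.prod_eq_single b]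
    · simp
    · intro b' _ hb'; simp [Function.update_of_ne hb']
    · simp
  have h2 : ∀ l : List β, ∏ b', listMean (u b') (l.count b')
      ((Function.update (fun _ _ => (1 : ℝ)) b (F b) : ∀ b, List (α b) → ℝ) b')
        = listMean (u b) (l.count b) (F b) := by
    intro l
    rw [Finset.prod_eq_single b]
    · simp
    · intro b' _ hb'; simp [Function.update_of_ne hb', listMean_const (hu b')]
    · simp
  simpa only [h1, h2] using h

end Blocks

/-! ### Limits of blockwise superadditive functions -/

/-- If `u` eventually exceeds each `v m` up to any `ε`, is bounded above, and `v - u → 0`, then `u`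
converges (to the supremum of `v`). -/
theorem exists_tendsto_of_eventually_le {u v : ℕ → ℝ} {C : ℝ} {m₀ : ℕ} (hu : ∀ n, u n ≤ C)
    (hv : ∀ n, v n ≤ u n) (huv : Tendsto (fun n => u n - v n) atTop (𝓝 0))
    (h : ∀ m, m₀ ≤ m → ∀ ε > 0, ∀ᶠ n in atTop, v m - ε ≤ u n) :
    ∃ r, Tendsto u atTop (𝓝 r) := by
  set S : Set ℝ := v '' Set.Ici m₀ with hS
  have hbdd : BddAbove S := ⟨C, by rintro _ ⟨m, -, rfl⟩; exact (hv m).trans (hu m)⟩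
  have hne : S.Nonempty := ⟨v m₀, m₀, Set.self_mem_Ici, rfl⟩
  -- `v ≤ sSup S` bounds `u` from above, and a near-maximal `v m` bounds it from below.
  refine ⟨sSup S, Metric.tendsto_atTop'.2 fun ε hε => ?_⟩
  obtain ⟨_, ⟨m, hm, rfl⟩, hmS⟩ := exists_lt_of_lt_csSup hne (sub_lt_self (sSup S) (half_pos hε))
  have hm' : m₀ ≤ m := hm
  have hclose : ∀ᶠ n in atTop, u n - v n < ε := huv.eventually (gt_mem_nhds hε)
  obtain ⟨N, hN⟩ := eventually_atTop.1 ((h m hm' (ε / 4) (by positivity)).and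
    (hclose.and (eventually_ge_atTop m₀)))
  refine ⟨N, fun n hn => ?_⟩
  obtain ⟨h1, h2, h3⟩ := hN n hn.le
  have h4 : v n ≤ sSup S := le_csSup hbdd ⟨n, h3, rfl⟩
  rw [Real.dist_eq, abs_lt]
  constructor <;> linarith

/-- The share of block `i` among blocks of sizes `n`. -/
noncomputable def blockShare {k : ℕ} (n : Fin (k + 1) → ℕ) (i : Fin (k + 1)) : ℝ :=
  (n i : ℝ) / ((∑ j, n j : ℕ) : ℝ)

theorem blockShare_nonneg {k : ℕ} (n : Fin (k + 1) → ℕ) (i : Fin (k + 1)) : 0 ≤ blockShare n i := by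
  unfold blockShare; positivity

theorem sum_blockShare {k : ℕ} {n : Fin (k + 1) → ℕ} (hn : ∀ i, 2 ≤ n i) :
    ∑ i, blockShare n i = 1 := by
  have hpos : 0 < ∑ j, n j := Finset.sum_pos (fun j _ => by have := hn j; omega) ⟨0, by simp⟩
  have hpos' : ((∑ j, n j : ℕ) : ℝ) ≠ 0 := by exact_mod_cast hpos.ne'
  unfold blockShare
  rw [← Finset.sum_div, ← Nat.cast_sum, div_self hpos']

/-- `Λ` is blockwise superadditive: splitting the nodes into blocks and the `M` edges into the
blocks at random, proportionally to the block sizes, does not increase `Λ` in the mean. -/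
def BlockSuperadditive (Λ : ℕ → ℕ → ℝ) : Prop :=
  ∀ (k : ℕ) (n : Fin (k + 1) → ℕ), (∀ i, 2 ≤ n i) → ∀ M,
    listMean (blockShare n) M (fun l => ∑ i, Λ (n i) (l.count i)) ≤ Λ (∑ i, n i) M

theorem abs_sub_le_of_abs_succ_sub_le {f : ℕ → ℝ} {D : ℝ} (h : ∀ k, |f (k + 1) - f k| ≤ D)
    (i j : ℕ) : |f i - f j| ≤ D * |(i : ℝ) - j| := by
  have aux : ∀ i d : ℕ, |f (i + d) - f i| ≤ D * d := by
    intro i d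
    induction d with
    | zero => simp
    | succ d ih =>
      calc |f (i + (d + 1)) - f i| ≤ |f (i + d + 1) - f (i + d)| + |f (i + d) - f i| :=
            abs_sub_le _ _ _
        _ ≤ D + D * d := add_le_add (h _) ih
        _ = D * (d + 1 : ℕ) := by push_cast; ring
  rcases le_total i j with hij | hij
  · obtain ⟨d, rfl⟩ := Nat.exists_eq_add_of_le hij
    have := aux i d
    rw [abs_sub_comm] at this
    simpa using this
  · obtain ⟨d, rfl⟩ := Nat.exists_eq_add_of_le hij
    simpa using aux j d

theorem abs_natFloor_sub_le {x : ℝ} (hx : 0 ≤ x) : |(⌊x⌋₊ : ℝ) - x| ≤ 1 := by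
  rw [abs_le]
  constructor
  · linarith [Nat.lt_floor_add_one x]
  · linarith [Nat.floor_le hx]

/-- The fluctuation of the random edge counts costs at most `ℓ n * (√(c n) + 2)` per block. -/
theorem sum_block_le {Λ : ℕ → ℕ → ℝ} {ℓ : ℕ → ℝ} (hsup : BlockSuperadditive Λ)
    (hℓ : ∀ n, 0 ≤ ℓ n)
    (hLip : ∀ n, 2 ≤ n → ∀ k, |Λ n (k + 1) - Λ n k| ≤ ℓ n) {c : ℝ} (hc : 0 ≤ c) (k : ℕ)
    (n : Fin (k + 1) → ℕ) (hn : ∀ i, 2 ≤ n i) :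
    ∑ i, (Λ (n i) ⌊c * n i⌋₊ - ℓ (n i) * (√(c * n i) + 2))
      ≤ Λ (∑ i, n i) ⌊c * (∑ i, n i : ℕ)⌋₊ := by
  set N := ∑ i, n i with hN
  set M := ⌊c * (N : ℝ)⌋₊ with hM
  have hw := blockShare_nonneg n
  have hw1 := sum_blockShare hn
  have hNpos : (0 : ℝ) < N := by
    have : 0 < ∑ j, n j := Finset.sum_pos (fun j _ => by have := hn j; omega) ⟨0, by simp⟩
    exact_mod_cast this
  refine le_trans ?_ (hsup k n hn M)
  rw [listMean_sum]
  refine Finset.sum_le_sum fun i _ => ?_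
  have hMabs := abs_natFloor_sub_le (x := c * N) (by positivity)
  rw [← hM] at hMabs
  have hshare : c * N * blockShare n i = c * n i := by
    unfold blockShare
    rw [← hN]
    field_simp
  have hshare1 : blockShare n i ≤ 1 := by
    rw [← hw1]
    exact Finset.single_le_sum (fun j _ => hw j) (Finset.mem_univ i)
  have hMw : |(M : ℝ) * blockShare n i - c * n i| ≤ 1 := by
    rw [← hshare, ← sub_mul, abs_mul, abs_of_nonneg (hw i)]
    exact mul_le_one₀ hMabs (hw i) hshare1
  have hpt : ∀ l : List (Fin (k + 1)), Λ (n i) ⌊c * n i⌋₊ - 2 * ℓ (n i)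
      - ℓ (n i) * |(l.count i : ℝ) - M * blockShare n i| ≤ Λ (n i) (l.count i) := by
    intro l
    have h1 := abs_sub_le_of_abs_succ_sub_le (hLip (n i) (hn i)) ⌊c * n i⌋₊ (l.count i)
    have h2 := abs_natFloor_sub_le (x := c * n i) (by positivity)
    have h3 : |(⌊c * n i⌋₊ : ℝ) - l.count i|
        ≤ 2 + |(l.count i : ℝ) - M * blockShare n i| := by
      rw [abs_le] at *
      have h4 := le_abs_self ((l.count i : ℝ) - M * blockShare n i)
      have h5 := neg_abs_le ((l.count i : ℝ) - M * blockShare n i)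
      constructor <;> linarith [h2.1, h2.2, hMw.1, hMw.2]
    have h4 := mul_le_mul_of_nonneg_left h3 (hℓ (n i))
    have h5 := (abs_le.1 h1).2
    linarith
  have hMle : (M : ℝ) * blockShare n i ≤ c * n i := by
    rw [← hshare]
    exact mul_le_mul_of_nonneg_right (Nat.floor_le (by positivity)) (hw i)
  have hmean := listMean_abs_count_sub_le hw hw1 i M
  calc Λ (n i) ⌊c * n i⌋₊ - ℓ (n i) * (√(c * n i) + 2)
      ≤ Λ (n i) ⌊c * n i⌋₊ - 2 * ℓ (n i) - ℓ (n i) *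
          listMean (blockShare n) M (fun l => |(l.count i : ℝ) - M * blockShare n i|) := by
        have := mul_le_mul_of_nonneg_left (hmean.trans (Real.sqrt_le_sqrt hMle)) (hℓ (n i))
        linarith
    _ = listMean (blockShare n) M (fun l => Λ (n i) ⌊c * n i⌋₊ - 2 * ℓ (n i)
          - ℓ (n i) * |(l.count i : ℝ) - M * blockShare n i|) := by
        rw [listMean_sub, listMean_const hw1, listMean_mul_left]
    _ ≤ _ := listMean_mono hw hpt

/-- A blockwise superadditive `Λ` whose increments in the number of edges are `o(√n)` has a limit
along `n⁻¹ Λ(n, ⌊c n⌋)`: `N` nodes are cut into blocks of a fixed size `m` and one block of size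
between `m` and `2 m`. -/
theorem BlockSuperadditive.exists_tendsto {Λ : ℕ → ℕ → ℝ} {ℓ : ℕ → ℝ} {C : ℝ}
    (hsup : BlockSuperadditive Λ) (hℓ : ∀ n, 0 ≤ ℓ n)
    (hℓ0 : Tendsto (fun n : ℕ => ℓ n / √n) atTop (𝓝 0))
    (hLip : ∀ n, 2 ≤ n → ∀ k, |Λ n (k + 1) - Λ n k| ≤ ℓ n) (hC : 0 ≤ C)
    (hup : ∀ n, 1 ≤ n → ∀ k, Λ n k ≤ C * (n + k)) {c : ℝ} (hc : 0 ≤ c) :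
    ∃ r, Tendsto (fun N : ℕ => Λ N ⌊c * N⌋₊ / N) atTop (𝓝 r) := by
  set a : ℕ → ℝ := fun n => Λ n ⌊c * n⌋₊ with ha
  set g : ℕ → ℝ := fun n => a n - ℓ n * (√(c * n) + 2) with hg
  have hga : ∀ n, g n ≤ a n := fun n => by
    have : 0 ≤ ℓ n * (√(c * n) + 2) := mul_nonneg (hℓ n) (by positivity)
    simp only [hg]; linarith
  refine exists_tendsto_of_eventually_le (u := fun N => a N / N) (v := fun n => g n / n)
    (C := C * (1 + c)) (m₀ := 2) ?_ ?_ ?_ ?_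
  · intro n
    rcases Nat.eq_zero_or_pos n with rfl | hn
    · simp; positivity
    · have hn' : (0 : ℝ) < n := by exact_mod_cast hn
      rw [div_le_iff₀ hn']
      have h1 : (⌊c * n⌋₊ : ℝ) ≤ c * n := Nat.floor_le (by positivity)
      have h2 := hup n hn ⌊c * n⌋₊
      have h3 := mul_le_mul_of_nonneg_left h1 hC
      simp only [ha]
      nlinarith
  · exact fun n => div_le_div_of_nonneg_right (hga n) (Nat.cast_nonneg n)
  · have h1 : Tendsto (fun n : ℕ => (√c + 2 / √n) * (ℓ n / √n)) atTop (𝓝 ((√c + 0) * 0)) := by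
      refine (tendsto_const_nhds.add ?_).mul hℓ0
      exact Tendsto.div_atTop tendsto_const_nhds
        (Real.tendsto_sqrt_atTop.comp tendsto_natCast_atTop_atTop)
    rw [mul_zero] at h1
    refine h1.congr' ?_
    filter_upwards [eventually_gt_atTop 0] with n hn
    have hn' : (0 : ℝ) < n := by exact_mod_cast hn
    have hs : 0 < √(n : ℝ) := Real.sqrt_pos.2 hn'
    have hss : √(n : ℝ) * √n = n := Real.mul_self_sqrt hn'.le
    simp only [hg]
    rw [Real.sqrt_mul hc, ← sub_div, sub_sub_cancel, eq_div_iff hn'.ne']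
    nth_rewrite 3 [← hss]
    field_simp
  · intro m hm ε hε
    have hmpos : (0 : ℝ) < m := by exact_mod_cast (by omega : 0 < m)
    -- `B` bounds the contribution of the last block, whose size takes finitely many values.
    set B : ℝ := ∑ r ∈ Finset.range (2 * m), |g r| with hB
    have hBr : ∀ r, r < 2 * m → -B ≤ g r := by
      intro r hr
      have : |g r| ≤ B := Finset.single_le_sum (f := fun r => |g r|) (fun i _ => abs_nonneg _)
        (Finset.mem_range.2 hr)
      have h2 := neg_abs_le (g r)
      linarith
    set D : ℝ := B + 2 * m * |g m / m| with hD
    have hDlim : Tendsto (fun N : ℕ => D / N) atTop (𝓝 0) :=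
      tendsto_const_nhds.div_atTop tendsto_natCast_atTop_atTop
    filter_upwards [hDlim.eventually (gt_mem_nhds hε), eventually_ge_atTop (2 * m)] with N hNε hN
    have hNpos : (0 : ℝ) < N := by exact_mod_cast (by omega : 0 < N)
    have hdiv : 2 ≤ N / m := (Nat.le_div_iff_mul_le (by omega)).2 hN
    obtain ⟨k, hk⟩ : ∃ k, N / m = k + 1 := ⟨N / m - 1, by omega⟩
    set r := N % m + m with hr
    have hr2 : r < 2 * m := by have := Nat.mod_lt N (by omega : 0 < m); omega
    have hNk : r + k * m = N := by
      have := Nat.div_add_mod N m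
      rw [hk, Nat.mul_succ, Nat.mul_comm] at this
      omega
    set n : Fin (k + 1) → ℕ := Fin.cons r (fun _ => m) with hn
    have hsum : ∑ i, n i = N := by simp [hn, Fin.sum_univ_succ, hNk]
    have hn2 : ∀ i, 2 ≤ n i := by
      intro i
      refine Fin.cases ?_ (fun j => ?_) i
      · simp only [hn, Fin.cons_zero]; omega
      · simpa [hn] using hm
    have key := sum_block_le hsup hℓ hLip hc k n hn2
    rw [hsum] at key
    have key2 : g r + k * g m ≤ a N := by
      refine le_trans (le_of_eq ?_) key
      rw [Fin.sum_univ_succ]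
      simp only [hn, hg, ha, Fin.cons_zero, Fin.cons_succ, Finset.sum_const, Finset.card_univ,
        Fintype.card_fin, nsmul_eq_mul]
    have hkm : (k : ℝ) * g m = (N - r) * (g m / m) := by
      have : (N : ℝ) = r + k * m := by exact_mod_cast hNk.symm
      rw [this]; field_simp; ring
    have hrle : (r : ℝ) ≤ 2 * m := by exact_mod_cast hr2.le
    have hfin : N * (g m / m) - D ≤ a N := by
      have h1 := hBr r hr2
      have h2 : (r : ℝ) * (g m / m) ≤ 2 * m * |g m / m| :=
        (mul_le_mul_of_nonneg_left (le_abs_self _) (Nat.cast_nonneg r)).trans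
          (mul_le_mul_of_nonneg_right hrle (abs_nonneg _))
      rw [hkm] at key2
      simp only [hD]
      nlinarith
    rw [le_div_iff₀ hNpos]
    rw [div_lt_iff₀ hNpos] at hNε
    nlinarith

/-! ### Penalty models -/

/-- A directed hyperedge on an arbitrary node set, with its mark. -/
abbrev HyperEdge (K : ℕ) (V : Type) : Type := (Fin K → V) × (Fin K → Fin 2)

/-- The weights of the uniform distribution. -/
noncomputable def uniformWeight (α : Type*) [Fintype α] : α → ℝ := fun _ => (Fintype.card α : ℝ)⁻¹

theorem uniformWeight_nonneg (α : Type*) [Fintype α] (a : α) : 0 ≤ uniformWeight α a := by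
  unfold uniformWeight; positivity

theorem sum_uniformWeight (α : Type*) [Fintype α] [Nonempty α] : ∑ a, uniformWeight α a = 1 := by
  simp [uniformWeight]

/-- A model whose edge potential takes the value `top` on good assignments of a hyperedge and
`top - cost` on bad ones; which assignments are bad depends on the mark. -/
structure PenaltyModel (K q : ℕ) where
  /-- the potential of a node -/
  node : Fin q → ℝ
  /-- the potential of a good hyperedge -/
  top : ℝ
  /-- the loss on a bad hyperedge -/
  cost : ℝ
  /-- the bad assignments of a hyperedge with a given mark -/
  bad : (Fin K → Fin 2) → (Fin K → Fin q) → Prop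

namespace PenaltyModel

variable {K q : ℕ} (m : PenaltyModel K q) {V : Type}

/-- The assignment `x` is bad on the hyperedge `e`. -/
def Viol (e : HyperEdge K V) (x : V → Fin q) : Prop := m.bad e.2 (fun k => x (e.1 k))

open Classical in
/-- The indicator that all assignments in `S` are bad on `e`. -/
noncomputable def allViol (S : Set (V → Fin q)) (e : HyperEdge K V) : ℝ :=
  if ∀ x ∈ S, m.Viol e x then 1 else 0

/-- The condition that makes the interpolation monotone: for every nonempty set `S` of assignments,
the number of marks for which all of `S` is bad on a tuple of nodes is a sum of `K`-fold tensor
powers of nonnegative functions on the nodes. -/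
def TensorConvex : Prop :=
  ∀ (V : Type) [Fintype V] (S : Set (V → Fin q)), S.Nonempty →
    ∃ (ι : Type) (_ : Fintype ι) (g : ι → V → ℝ), (∀ i v, 0 ≤ g i v) ∧
      ∀ e : Fin K → V, ∑ a, m.allViol S (e, a) = ∑ i, ∏ k, g i (e k)

open Classical in
/-- The potential of a hyperedge. -/
noncomputable def edgeValue (e : HyperEdge K V) (x : V → Fin q) : ℝ :=
  m.top - m.cost * if m.Viol e x then 1 else 0

/-- The value of an assignment on a list of hyperedges. -/
noncomputable def value [Fintype V] (L : List (HyperEdge K V)) (x : V → Fin q) : ℝ :=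
  ∑ v, m.node (x v) + (L.map fun e => m.edgeValue e x).sum

/-- The optimal value on a list of hyperedges. -/
noncomputable def best [Fintype V] (L : List (HyperEdge K V)) : ℝ := ⨆ x, m.value L x

/-- Some assignment is good on all hyperedges of the list. -/
def Sat (L : List (HyperEdge K V)) : Prop := ∃ x, ∀ e ∈ L, ¬ m.Viol e x

open Classical in
/-- The indicator of satisfiability. -/
noncomputable def satInd (L : List (HyperEdge K V)) : ℝ := if m.Sat L then 1 else 0

variable {m}

theorem edgeValue_le (hm : 0 ≤ m.cost) (e : HyperEdge K V) (x : V → Fin q) :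
    m.edgeValue e x ≤ m.top := by
  unfold edgeValue; split_ifs <;> linarith

theorem le_edgeValue (hm : 0 ≤ m.cost) (e : HyperEdge K V) (x : V → Fin q) :
    m.top - m.cost ≤ m.edgeValue e x := by
  unfold edgeValue; split_ifs <;> linarith

section Best

variable [Fintype V]

theorem value_le_best (L : List (HyperEdge K V)) (x : V → Fin q) : m.value L x ≤ m.best L :=
  le_ciSup (f := fun x => m.value L x) (Set.finite_range _).bddAbove x

theorem exists_value_eq_best [NeZero q] (L : List (HyperEdge K V)) :
    ∃ x, m.value L x = m.best L :=
  exists_eq_ciSup_of_finite (f := fun x => m.value L x)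

theorem value_insert (L₁ L₂ : List (HyperEdge K V)) (e : HyperEdge K V) (x : V → Fin q) :
    m.value (L₁ ++ e :: L₂) x = m.value (L₁ ++ L₂) x + m.edgeValue e x := by
  simp only [value, List.map_append, List.map_cons, List.sum_append, List.sum_cons]; ring

theorem best_insert_le [NeZero q] (hm : 0 ≤ m.cost) (L₁ L₂ : List (HyperEdge K V))
    (e : HyperEdge K V) : m.best (L₁ ++ e :: L₂) ≤ m.best (L₁ ++ L₂) + m.top := by
  obtain ⟨x, hx⟩ := m.exists_value_eq_best (L₁ ++ e :: L₂)
  rw [← hx, value_insert]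
  exact add_le_add (value_le_best _ _) (edgeValue_le hm e x)

theorem le_best_insert [NeZero q] (hm : 0 ≤ m.cost) (L₁ L₂ : List (HyperEdge K V))
    (e : HyperEdge K V) : m.best (L₁ ++ L₂) + (m.top - m.cost) ≤ m.best (L₁ ++ e :: L₂) := by
  obtain ⟨x, hx⟩ := m.exists_value_eq_best (L₁ ++ L₂)
  refine le_trans ?_ (value_le_best _ x)
  rw [← hx, value_insert]
  exact add_le_add le_rfl (le_edgeValue hm e x)

/-- The loss caused by a new hyperedge exceeds `t` exactly when all assignments that are optimal up
to `t` are bad on it. -/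
theorem lt_loss_iff [NeZero q] (L₁ L₂ : List (HyperEdge K V)) (e : HyperEdge K V) {t : ℝ}
    (ht : t < m.cost) :
    t < m.best (L₁ ++ L₂) + m.top - m.best (L₁ ++ e :: L₂) ↔
      ∀ x ∈ {x | m.best (L₁ ++ L₂) - t ≤ m.value (L₁ ++ L₂) x}, m.Viol e x := by
  constructor
  · intro h x hx
    by_contra hgood
    have h1 := value_le_best (m := m) (L₁ ++ e :: L₂) x
    rw [value_insert, edgeValue, if_neg hgood] at h1
    have h2 : m.best (L₁ ++ L₂) - t ≤ m.value (L₁ ++ L₂) x := hx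
    linarith
  · intro h
    obtain ⟨x, hx⟩ := m.exists_value_eq_best (L₁ ++ e :: L₂)
    rw [← hx, value_insert, edgeValue]
    have h1 := value_le_best (m := m) (L₁ ++ L₂) x
    by_cases hgood : m.Viol e x
    · rw [if_pos hgood]; linarith
    · rw [if_neg hgood]
      have h2 : ¬ m.best (L₁ ++ L₂) - t ≤ m.value (L₁ ++ L₂) x := fun hx' => hgood (h x hx')
      linarith

end Best

end PenaltyModel

/-- Averages can be compared level by level. -/
theorem sum_mul_le_of_level {I J : Type*} [Fintype I] [Fintype J] {w D : I → ℝ} {w' D' : J → ℝ}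
    {b : ℝ} (hD : ∀ i, 0 ≤ D i ∧ D i ≤ b) (hD' : ∀ j, 0 ≤ D' j ∧ D' j ≤ b)
    (h : ∀ t, 0 ≤ t → t < b → ∑ i, w i * (Iio (D i)).indicator 1 t
      ≤ ∑ j, w' j * (Iio (D' j)).indicator 1 t) :
    ∑ i, w i * D i ≤ ∑ j, w' j * D' j := by
  have hint : ∀ d : ℝ, Integrable ((Iio d).indicator (1 : ℝ → ℝ)) (volume.restrict (Ico 0 b)) := by
    intro d
    exact (integrable_const (1 : ℝ)).indicator measurableSet_Iio
  have hval : ∀ d : ℝ, 0 ≤ d → d ≤ b →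
      ∫ t in Ico 0 b, (Iio d).indicator (1 : ℝ → ℝ) t = d := by
    intro d hd hdb
    have hset : Iio d ∩ Ico 0 b = Ico 0 d := by
      ext t
      simp only [mem_inter_iff, mem_Iio, mem_Ico]
      constructor
      · rintro ⟨h1, h2, -⟩; exact ⟨h2, h1⟩
      · rintro ⟨h1, h2⟩; exact ⟨h2, h1, h2.trans_le hdb⟩
    rw [integral_indicator_one measurableSet_Iio, measureReal_restrict_apply measurableSet_Iio,
      hset]
    simp [hd]
  have h1 : ∫ t in Ico 0 b, ∑ i, w i * (Iio (D i)).indicator (1 : ℝ → ℝ) t = ∑ i, w i * D i := by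
    rw [integral_finsetSum _ fun i _ => (hint (D i)).const_mul (w i)]
    exact Finset.sum_congr rfl fun i _ => by
      rw [integral_const_mul, hval _ (hD i).1 (hD i).2]
  have h2 : ∫ t in Ico 0 b, ∑ j, w' j * (Iio (D' j)).indicator (1 : ℝ → ℝ) t
      = ∑ j, w' j * D' j := by
    rw [integral_finsetSum _ fun j _ => (hint (D' j)).const_mul (w' j)]
    exact Finset.sum_congr rfl fun j _ => by
      rw [integral_const_mul, hval _ (hD' j).1 (hD' j).2]
  rw [← h1, ← h2]
  exact setIntegral_mono_on (integrable_finsetSum _ fun i _ => (hint _).const_mul _)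
    (integrable_finsetSum _ fun j _ => (hint _).const_mul _) measurableSet_Ico
    fun t ht => h t ht.1 ht.2

/-! ### The interpolation step -/

section Interpolation

variable {K q k : ℕ} {n : Fin (k + 1) → ℕ}

/-- The nodes, grouped into blocks. -/
abbrev BlockNode (n : Fin (k + 1) → ℕ) : Type := Σ i, Fin (n i)

/-- A hyperedge of one block, as a hyperedge on all nodes. -/
def inBlock (s : Σ i, HyperEdge K (Fin (n i))) : HyperEdge K (BlockNode n) :=
  (fun k => ⟨s.1, s.2.1 k⟩, s.2.2)

/-- The distribution of a local hyperedge: a block with probability proportional to its size, and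
then a uniform hyperedge inside it. -/
noncomputable def localWeight (K : ℕ) (n : Fin (k + 1) → ℕ)
    (s : Σ i, HyperEdge K (Fin (n i))) : ℝ :=
  blockShare n s.1 * uniformWeight (HyperEdge K (Fin (n s.1))) s.2

theorem localWeight_nonneg (s : Σ i, HyperEdge K (Fin (n i))) : 0 ≤ localWeight K n s :=
  mul_nonneg (blockShare_nonneg n _) (uniformWeight_nonneg _ _)

theorem nonempty_hyperEdge (hn : ∀ i, 2 ≤ n i) (i : Fin (k + 1)) :
    Nonempty (HyperEdge K (Fin (n i))) :=
  ⟨(fun _ => ⟨0, by have := hn i; omega⟩, fun _ => 0)⟩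

theorem nonempty_hyperEdge_blockNode (hn : ∀ i, 2 ≤ n i) :
    Nonempty (HyperEdge K (BlockNode n)) :=
  ⟨(fun _ => ⟨0, ⟨0, by have := hn 0; omega⟩⟩, fun _ => 0)⟩

theorem sum_localWeight (hn : ∀ i, 2 ≤ n i) : ∑ s, localWeight K n s = 1 := by
  simp only [localWeight, Fintype.sum_sigma, ← Finset.mul_sum]
  rw [← sum_blockShare hn]
  refine Finset.sum_congr rfl fun i _ => ?_
  have := nonempty_hyperEdge (K := K) hn i
  rw [sum_uniformWeight, mul_one]

/-- The power mean inequality for block averages. -/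
theorem pow_sum_div_le (hn : ∀ i, 2 ≤ n i) {g : BlockNode n → ℝ} (hg : ∀ v, 0 ≤ g v) :
    (((∑ i, n i : ℕ) : ℝ) ^ K)⁻¹ * (∑ v, g v) ^ K
      ≤ ∑ i, blockShare n i * (((n i : ℝ) ^ K)⁻¹ * (∑ v, g ⟨i, v⟩) ^ K) := by
  have h := Real.pow_arith_mean_le_arith_mean_pow Finset.univ (blockShare n)
    (fun i => (∑ v, g ⟨i, v⟩) / n i) (fun i _ => blockShare_nonneg n i) (sum_blockShare hn)
    (fun i _ => div_nonneg (Finset.sum_nonneg fun v _ => hg _) (Nat.cast_nonneg _)) K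
  have h1 : ∑ i, blockShare n i * ((∑ v, g ⟨i, v⟩) / n i)
      = (∑ v, g v) / ((∑ i, n i : ℕ) : ℝ) := by
    rw [Fintype.sum_sigma, Finset.sum_div]
    refine Finset.sum_congr rfl fun i _ => ?_
    have : (n i : ℝ) ≠ 0 := by have := hn i; exact_mod_cast (by omega : n i ≠ 0)
    unfold blockShare
    field_simp
  rw [h1] at h
  simp only [div_pow] at h
  simpa only [div_eq_inv_mul] using h

/-- A uniform hyperedge is bad for all of `S` with at most the probability that a local one is. -/
theorem PenaltyModel.TensorConvex.sum_allViol_le {m : PenaltyModel K q} (hc : m.TensorConvex)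
    (hn : ∀ i, 2 ≤ n i) {S : Set (BlockNode n → Fin q)} (hS : S.Nonempty) :
    ∑ e, uniformWeight (HyperEdge K (BlockNode n)) e * m.allViol S e
      ≤ ∑ s, localWeight K n s * m.allViol S (inBlock s) := by
  obtain ⟨ι, _, g, hg, hcount⟩ := hc _ S hS
  have hpow : ∀ {V : Type} [Fintype V] (f : V → ℝ),
      ∑ e : Fin K → V, ∏ k, f (e k) = (∑ v, f v) ^ K := fun f => (Fintype.sum_pow f K).symm
  have hL : ∑ e, uniformWeight (HyperEdge K (BlockNode n)) e * m.allViol S e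
      = ((2 : ℝ) ^ K)⁻¹ * ∑ i, ((((∑ j, n j : ℕ) : ℝ) ^ K)⁻¹ * (∑ v, g i v) ^ K) := by
    simp only [uniformWeight, ← Finset.mul_sum]
    rw [Fintype.sum_prod_type]
    simp only [hcount]
    rw [Finset.sum_comm]
    simp only [hpow, Fintype.card_prod, Fintype.card_fun, Fintype.card_fin, Fintype.card_sigma]
    push_cast
    rw [mul_inv]; ring
  have hR : ∑ s, localWeight K n s * m.allViol S (inBlock s)
      = ((2 : ℝ) ^ K)⁻¹ * ∑ i, ∑ j, blockShare n j *
          (((n j : ℝ) ^ K)⁻¹ * (∑ v, g i ⟨j, v⟩) ^ K) := by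
    rw [Fintype.sum_sigma, Finset.sum_comm (s := (Finset.univ : Finset ι)), Finset.mul_sum]
    refine Finset.sum_congr rfl fun j _ => ?_
    have hlocal : ∑ e : HyperEdge K (Fin (n j)), m.allViol S (inBlock ⟨j, e⟩)
        = ∑ i, (∑ v, g i ⟨j, v⟩) ^ K := by
      rw [Fintype.sum_prod_type]
      calc _ = ∑ e : Fin K → Fin (n j), ∑ i, ∏ k, g i ⟨j, e k⟩ :=
            Finset.sum_congr rfl fun e _ => hcount fun k => ⟨j, e k⟩
        _ = _ := by
            rw [Finset.sum_comm]
            exact Finset.sum_congr rfl fun i _ => hpow fun v => g i ⟨j, v⟩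
    have hfactor : ∑ e : HyperEdge K (Fin (n j)),
        localWeight K n ⟨j, e⟩ * m.allViol S (inBlock ⟨j, e⟩)
          = blockShare n j * (Fintype.card (HyperEdge K (Fin (n j))) : ℝ)⁻¹ *
            ∑ e : HyperEdge K (Fin (n j)), m.allViol S (inBlock ⟨j, e⟩) := by
      rw [Finset.mul_sum]; rfl
    rw [hfactor, hlocal, ← Finset.mul_sum, ← Finset.mul_sum]
    simp only [Fintype.card_prod, Fintype.card_fun, Fintype.card_fin]
    push_cast
    rw [mul_inv]; ring
  rw [hL, hR]
  refine mul_le_mul_of_nonneg_left (Finset.sum_le_sum fun i _ => ?_) (by positivity)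
  exact pow_sum_div_le hn (hg i)

/-- Replacing a uniform hyperedge by a local one does not increase the mean optimal value. -/
theorem PenaltyModel.TensorConvex.sum_best_le [NeZero q] {m : PenaltyModel K q}
    (hc : m.TensorConvex) (hm : 0 ≤ m.cost) (hn : ∀ i, 2 ≤ n i)
    (L₁ L₂ : List (HyperEdge K (BlockNode n))) :
    ∑ s, localWeight K n s * m.best (L₁ ++ inBlock s :: L₂)
      ≤ ∑ e, uniformWeight (HyperEdge K (BlockNode n)) e * m.best (L₁ ++ e :: L₂) := by
  have := nonempty_hyperEdge_blockNode (K := K) hn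
  set A := m.best (L₁ ++ L₂) + m.top with hA
  have hloss : ∀ e, 0 ≤ A - m.best (L₁ ++ e :: L₂) ∧ A - m.best (L₁ ++ e :: L₂) ≤ m.cost := by
    intro e
    have h1 := m.best_insert_le hm L₁ L₂ e
    have h2 := m.le_best_insert hm L₁ L₂ e
    constructor <;> linarith
  have key := sum_mul_le_of_level (w := uniformWeight (HyperEdge K (BlockNode n)))
    (w' := localWeight K n) (D := fun e => A - m.best (L₁ ++ e :: L₂))
    (D' := fun s => A - m.best (L₁ ++ inBlock s :: L₂)) (b := m.cost) hloss
    (fun s => hloss _) ?_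
  · simp only [mul_sub, Finset.sum_sub_distrib, ← Finset.sum_mul, sum_uniformWeight,
      sum_localWeight hn] at key
    linarith
  · intro t ht ht'
    have hind : ∀ e, (Iio (A - m.best (L₁ ++ e :: L₂))).indicator (1 : ℝ → ℝ) t
        = m.allViol {x | m.best (L₁ ++ L₂) - t ≤ m.value (L₁ ++ L₂) x} e := by
      intro e
      have h := m.lt_loss_iff L₁ L₂ e ht'
      unfold allViol
      by_cases h' : t < A - m.best (L₁ ++ e :: L₂)
      · rw [if_pos (h.1 h'), Set.indicator_of_mem (mem_Iio.2 h')]; rfl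
      · rw [if_neg (mt h.2 h'), Set.indicator_of_notMem (by simpa using h')]
    simp only [hind]
    obtain ⟨x, hx⟩ := m.exists_value_eq_best (L₁ ++ L₂)
    exact hc.sum_allViol_le hn ⟨x, by simp only [mem_ofPred_eq]; linarith⟩

/-- Replacing a uniform hyperedge by a local one does not increase the probability of
satisfiability. -/
theorem PenaltyModel.TensorConvex.sum_satInd_le {m : PenaltyModel K q}
    (hc : m.TensorConvex) (hn : ∀ i, 2 ≤ n i) (L₁ L₂ : List (HyperEdge K (BlockNode n))) :
    ∑ s, localWeight K n s * m.satInd (L₁ ++ inBlock s :: L₂)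
      ≤ ∑ e, uniformWeight (HyperEdge K (BlockNode n)) e * m.satInd (L₁ ++ e :: L₂) := by
  have := nonempty_hyperEdge_blockNode (K := K) hn
  set S : Set (BlockNode n → Fin q) := {x | ∀ e ∈ L₁ ++ L₂, ¬ m.Viol e x} with hS
  have hsat : ∀ e, m.Sat (L₁ ++ e :: L₂) ↔ ∃ x ∈ S, ¬ m.Viol e x := by
    intro e
    unfold Sat
    refine exists_congr fun x => ?_
    simp only [hS, mem_ofPred_eq, List.mem_append, List.mem_cons]
    constructor
    · exact fun h => ⟨fun e' he' => h e' (by tauto), h e (by tauto)⟩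
    · rintro ⟨h1, h2⟩ e' (he' | rfl | he')
      exacts [h1 e' (Or.inl he'), h2, h1 e' (Or.inr he')]
  rcases S.eq_empty_or_nonempty with hempty | hne
  · have : ∀ e, m.satInd (L₁ ++ e :: L₂) = 0 := by
      intro e
      unfold satInd
      rw [if_neg]
      rw [hsat, hempty]; simp
    simp [this]
  · have hind : ∀ e, m.satInd (L₁ ++ e :: L₂) = 1 - m.allViol S e := by
      intro e
      unfold satInd allViol
      by_cases h : ∀ x ∈ S, m.Viol e x
      · rw [if_pos h, if_neg]
        · norm_num
        · rw [hsat]; push Not; exact h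
      · rw [if_neg h, if_pos]
        · norm_num
        · rw [hsat]; push Not at h; exact h
    have key := hc.sum_allViol_le hn hne
    simp only [hind, mul_sub, Finset.sum_sub_distrib, mul_one, sum_uniformWeight,
      sum_localWeight hn]
    linarith

end Interpolation

/-! ### Blockwise superadditivity of the ground state and of the satisfiability rate -/

theorem mem_blockPart {β : Type*} [DecidableEq β] {α : β → Type*} {b : β} {a : α b}
    {L : List (Σ b, α b)} : a ∈ blockPart b L ↔ (⟨b, a⟩ : Σ b, α b) ∈ L := by
  induction L with
  | nil => simp [blockPart]
  | cons s L ih =>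
    obtain ⟨b', a'⟩ := s
    by_cases h : b' = b
    · subst h; simp [blockPart_cons_self, ih]
    · rw [blockPart_cons_ne h, ih]
      simp only [List.mem_cons]
      constructor
      · exact Or.inr
      · rintro (h' | h')
        · exact absurd (congrArg Sigma.fst h').symm h
        · exact h'

/-- The hyperedges inside block `i`. -/
abbrev BlockEdge {k : ℕ} (K : ℕ) (n : Fin (k + 1) → ℕ) (i : Fin (k + 1)) : Type :=
  HyperEdge K (Fin (n i))

namespace PenaltyModel

variable {K q k : ℕ} {n : Fin (k + 1) → ℕ} {m : PenaltyModel K q}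

theorem value_map_inBlock (L : List (Σ i, HyperEdge K (Fin (n i)))) (x : BlockNode n → Fin q) :
    m.value (L.map inBlock) x
      = ∑ i, m.value (blockPart (α := BlockEdge K n) i L) (fun v => x ⟨i, v⟩) := by
  induction L with
  | nil => simp [value, blockPart, Fintype.sum_sigma]
  | cons s L ih =>
    obtain ⟨j, e⟩ := s
    have h1 := m.value_insert [] (L.map inBlock) (inBlock ⟨j, e⟩) x
    simp only [List.nil_append] at h1
    rw [List.map_cons, h1, ih, ← Finset.add_sum_erase _ _ (Finset.mem_univ j),
      ← Finset.add_sum_erase _ _ (Finset.mem_univ j), blockPart_cons_self]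
    have h2 := m.value_insert [] (blockPart (α := BlockEdge K n) j L) e (fun v => x ⟨j, v⟩)
    simp only [List.nil_append] at h2
    have h3 : m.edgeValue (inBlock ⟨j, e⟩) x = m.edgeValue e (fun v => x ⟨j, v⟩) := rfl
    have h4 : ∀ i ∈ Finset.univ.erase j,
        m.value (blockPart (α := BlockEdge K n) i (⟨j, e⟩ :: L)) (fun v => x ⟨i, v⟩)
        = m.value (blockPart (α := BlockEdge K n) i L) (fun v => x ⟨i, v⟩) := fun i hi => by
      rw [blockPart_cons_ne (Finset.ne_of_mem_erase hi).symm]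
    rw [Finset.sum_congr rfl h4, h2, h3]
    ring

theorem best_map_inBlock [NeZero q] (L : List (Σ i, HyperEdge K (Fin (n i)))) :
    m.best (L.map inBlock) = ∑ i, m.best (blockPart (α := BlockEdge K n) i L) := by
  apply le_antisymm
  · obtain ⟨x, hx⟩ := m.exists_value_eq_best (L.map inBlock)
    rw [← hx, value_map_inBlock]
    exact Finset.sum_le_sum fun i _ => value_le_best _ _
  · choose x hx using fun i => m.exists_value_eq_best (blockPart (α := BlockEdge K n) i L)
    have := m.value_le_best (L.map inBlock) (fun v => x v.1 v.2)
    rw [value_map_inBlock] at this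
    simpa only [hx] using this

theorem sat_map_inBlock (L : List (Σ i, HyperEdge K (Fin (n i)))) :
    m.Sat (L.map inBlock) ↔ ∀ i, m.Sat (blockPart (α := BlockEdge K n) i L) := by
  constructor
  · rintro ⟨x, hx⟩ i
    exact ⟨fun v => x ⟨i, v⟩, fun e he => hx _ (List.mem_map_of_mem (mem_blockPart.1 he))⟩
  · intro h
    choose x hx using h
    refine ⟨fun v => x v.1 v.2, fun e he => ?_⟩
    obtain ⟨⟨i, e'⟩, he', rfl⟩ := List.mem_map.1 he
    exact hx i e' (mem_blockPart.2 he')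

theorem satInd_map_inBlock (L : List (Σ i, HyperEdge K (Fin (n i)))) :
    m.satInd (L.map inBlock) = ∏ i, m.satInd (blockPart (α := BlockEdge K n) i L) := by
  unfold satInd
  by_cases h : ∀ i, m.Sat (blockPart (α := BlockEdge K n) i L)
  · rw [if_pos ((sat_map_inBlock L).2 h)]
    simp [h]
  · rw [if_neg (mt (sat_map_inBlock L).1 h)]
    push Not at h
    obtain ⟨i, hi⟩ := h
    exact (Finset.prod_eq_zero (Finset.mem_univ i) (by simp [hi])).symm

end PenaltyModel

/-- Renaming the nodes of a hyperedge. -/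
def hyperEdgeEquiv (K : ℕ) {V V' : Type} (σ : V ≃ V') : HyperEdge K V ≃ HyperEdge K V' :=
  (Equiv.arrowCongr (Equiv.refl _) σ).prodCongr (Equiv.refl _)

theorem listMean_uniform_equiv {α α' : Type*} [Fintype α] [Fintype α'] (φ : α' ≃ α) (M : ℕ)
    (F : List α → ℝ) :
    listMean (uniformWeight α') M (fun L => F (L.map φ)) = listMean (uniformWeight α) M F := by
  rw [← listMean_equiv φ M F]
  have : uniformWeight α' = fun a => uniformWeight α (φ a) := by
    funext a; simp [uniformWeight, Fintype.card_congr φ]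
  rw [this]

namespace PenaltyModel

variable {K q k : ℕ} {n : Fin (k + 1) → ℕ} {m : PenaltyModel K q}

theorem value_map_equiv {V V' : Type} [Fintype V] [Fintype V'] (σ : V ≃ V')
    (L : List (HyperEdge K V)) (x : V' → Fin q) :
    m.value (L.map (hyperEdgeEquiv K σ)) x = m.value L (x ∘ σ) := by
  unfold value
  rw [List.map_map, ← σ.sum_comp]
  rfl

theorem best_map_equiv {V V' : Type} [Fintype V] [Fintype V'] (σ : V ≃ V')
    (L : List (HyperEdge K V)) : m.best (L.map (hyperEdgeEquiv K σ)) = m.best L := by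
  calc m.best (L.map (hyperEdgeEquiv K σ)) = ⨆ x : V' → Fin q, m.value L (x ∘ σ) :=
        iSup_congr fun x => value_map_equiv σ L x
    _ = m.best L :=
        (σ.arrowCongr (Equiv.refl (Fin q))).symm.iSup_comp (g := fun x => m.value L x)

theorem satInd_map_equiv {V V' : Type} (σ : V ≃ V')
    (L : List (HyperEdge K V)) : m.satInd (L.map (hyperEdgeEquiv K σ)) = m.satInd L := by
  have : m.Sat (L.map (hyperEdgeEquiv K σ)) ↔ m.Sat L := by
    constructor
    · rintro ⟨x, hx⟩
      exact ⟨x ∘ σ, fun e he => hx _ (List.mem_map_of_mem he)⟩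
    · rintro ⟨x, hx⟩
      refine ⟨x ∘ σ.symm, fun e he => ?_⟩
      obtain ⟨e', he', rfl⟩ := List.mem_map.1 he
      have := hx e' he'
      simpa [Viol, hyperEdgeEquiv] using this
  by_cases h : m.Sat L
  · rw [show m.satInd L = 1 from if_pos h]; exact if_pos (this.2 h)
  · rw [show m.satInd L = 0 from if_neg h]; exact if_neg (mt this.1 h)

variable (m) in
/-- The mean optimal value with `N` nodes and `M` hyperedges. -/
noncomputable def meanBest (N M : ℕ) : ℝ :=
  listMean (uniformWeight (HyperEdge K (Fin N))) M m.best

variable (m) in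
/-- The probability of satisfiability with `N` nodes and `M` hyperedges. -/
noncomputable def satMean (N M : ℕ) : ℝ :=
  listMean (uniformWeight (HyperEdge K (Fin N))) M m.satInd

theorem sum_uniformWeight_hyperEdge {N : ℕ} (hN : 1 ≤ N) :
    ∑ e, uniformWeight (HyperEdge K (Fin N)) e = 1 := by
  have : Nonempty (HyperEdge K (Fin N)) := ⟨(fun _ => ⟨0, hN⟩, fun _ => 0)⟩
  exact sum_uniformWeight _

/-- Interpolating edge by edge between the whole graph and its blocks. -/
theorem TensorConvex.blockSuperadditive_meanBest [NeZero q] (hc : m.TensorConvex)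
    (hm : 0 ≤ m.cost) : BlockSuperadditive m.meanBest := by
  intro k n hn M
  have h1 := listMean_sum_blockPart (ρ := blockShare n)
    (u := fun i => uniformWeight (HyperEdge K (Fin (n i))))
    (fun i => sum_uniformWeight_hyperEdge (by have := hn i; omega)) M
    (fun i => m.best)
  simp only [← best_map_inBlock] at h1
  have h2 := listMean_uniform_equiv (hyperEdgeEquiv K (finSigmaFinEquiv (n := n))) M m.best
  simp only [best_map_equiv] at h2
  unfold meanBest
  rw [← h1, ← h2]
  exact listMean_map_le (uniformWeight_nonneg _) localWeight_nonneg inBlock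
    (fun L₁ L₂ => hc.sum_best_le hm hn L₁ L₂) M

theorem TensorConvex.blockSuperadditive_log_satMean (hc : m.TensorConvex)
    (hpos : ∀ N, 2 ≤ N → ∀ M, 0 < m.satMean N M) :
    BlockSuperadditive fun N M => Real.log (m.satMean N M) := by
  intro k n hn M
  have h1 := listMean_prod_blockPart (blockShare n)
    (fun i => uniformWeight (HyperEdge K (Fin (n i)))) M (fun i => m.satInd)
  simp only [← satInd_map_inBlock] at h1
  have h2 := listMean_uniform_equiv (hyperEdgeEquiv K (finSigmaFinEquiv (n := n))) M m.satInd
  simp only [satInd_map_equiv] at h2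
  have h3 := listMean_map_le (uniformWeight_nonneg _) localWeight_nonneg inBlock
    (fun L₁ L₂ => hc.sum_satInd_le hn L₁ L₂) M
  have h4 := listMean_log_le (blockShare_nonneg n) (sum_blockShare hn) M
    (F := fun l => ∏ i, m.satMean (n i) (l.count i))
    (fun l => Finset.prod_pos fun i _ => hpos _ (hn i) _)
  have h5 : ∀ l : List (Fin (k + 1)), Real.log (∏ i, m.satMean (n i) (l.count i))
      = ∑ i, Real.log (m.satMean (n i) (l.count i)) :=
    fun l => Real.log_prod fun i _ => (hpos _ (hn i) _).ne'
  simp only [h5] at h4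
  refine h4.1.trans (Real.log_le_log h4.2 ?_)
  calc listMean (blockShare n) M (fun l => ∏ i, m.satMean (n i) (l.count i))
      = listMean (localWeight K n) M (fun L => m.satInd (L.map inBlock)) := h1.symm
    _ ≤ m.satMean (∑ i, n i) M := by rw [satMean, ← h2]; exact h3

/-! ### Limits of the means -/

theorem meanBest_succ_le [NeZero q] (hm : 0 ≤ m.cost) {N : ℕ} (hN : 1 ≤ N) (M : ℕ) :
    m.meanBest N (M + 1) ≤ m.meanBest N M + m.top := by
  unfold meanBest
  rw [listMean_succ, ← listMean_const (sum_uniformWeight_hyperEdge (K := K) hN) M m.top,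
    ← listMean_add]
  refine listMean_mono (uniformWeight_nonneg _) fun L => ?_
  calc _ ≤ ∑ e, uniformWeight (HyperEdge K (Fin N)) e * (m.best L + m.top) :=
        Finset.sum_le_sum fun e _ => mul_le_mul_of_nonneg_left (m.best_insert_le hm [] L e)
          (uniformWeight_nonneg _ _)
    _ = _ := by rw [← Finset.sum_mul, sum_uniformWeight_hyperEdge hN, one_mul]

theorem le_meanBest_succ [NeZero q] (hm : 0 ≤ m.cost) {N : ℕ} (hN : 1 ≤ N) (M : ℕ) :
    m.meanBest N M + (m.top - m.cost) ≤ m.meanBest N (M + 1) := by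
  unfold meanBest
  rw [listMean_succ,
    ← listMean_const (sum_uniformWeight_hyperEdge (K := K) hN) M (m.top - m.cost),
    ← listMean_add]
  refine listMean_mono (uniformWeight_nonneg _) fun L => ?_
  calc _ = ∑ e, uniformWeight (HyperEdge K (Fin N)) e * (m.best L + (m.top - m.cost)) := by
        rw [← Finset.sum_mul, sum_uniformWeight_hyperEdge hN, one_mul]
    _ ≤ _ := Finset.sum_le_sum fun e _ => mul_le_mul_of_nonneg_left (m.le_best_insert hm [] L e)
          (uniformWeight_nonneg _ _)

theorem abs_meanBest_succ_sub_le [NeZero q] (hm : 0 ≤ m.cost) {D : ℝ} (h1 : m.top ≤ D)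
    (h2 : -D ≤ m.top - m.cost) {N : ℕ} (hN : 1 ≤ N) (M : ℕ) :
    |m.meanBest N (M + 1) - m.meanBest N M| ≤ D := by
  have h3 := m.meanBest_succ_le hm hN M
  have h4 := m.le_meanBest_succ hm hN M
  rw [abs_le]
  constructor <;> linarith

theorem meanBest_le [NeZero q] (hm : 0 ≤ m.cost) {N : ℕ} (hN : 1 ≤ N) (M : ℕ) :
    m.meanBest N M ≤ (∑ s, |m.node s| + |m.top|) * (N + M) := by
  have hA : 0 ≤ ∑ s, |m.node s| := Finset.sum_nonneg fun s _ => abs_nonneg _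
  induction M with
  | zero =>
    obtain ⟨x, hx⟩ := m.exists_value_eq_best ([] : List (HyperEdge K (Fin N)))
    have h1 : m.meanBest N 0 ≤ N * ∑ s, |m.node s| := by
      calc m.meanBest N 0 = m.best [] := rfl
        _ = ∑ v, m.node (x v) := by rw [← hx]; simp [value]
        _ ≤ ∑ _v : Fin N, ∑ s, |m.node s| := Finset.sum_le_sum fun v _ =>
            (le_abs_self _).trans (Finset.single_le_sum (f := fun s => |m.node s|)
              (fun s _ => abs_nonneg _) (Finset.mem_univ (x v)))
        _ = _ := by simp
    have h2 : 0 ≤ |m.top| * N := by positivity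
    push_cast
    linarith
  | succ M ih =>
    have h1 := m.meanBest_succ_le hm hN M
    have h2 := le_abs_self m.top
    push_cast
    linarith

theorem TensorConvex.exists_tendsto_meanBest [NeZero q] (hc : m.TensorConvex)
    (hm : 0 ≤ m.cost) {c : ℝ} (hc0 : 0 ≤ c) :
    ∃ r, Tendsto (fun N : ℕ => m.meanBest N ⌊c * N⌋₊ / N) atTop (𝓝 r) := by
  have hA : 0 ≤ ∑ s, |m.node s| := Finset.sum_nonneg fun s _ => abs_nonneg _
  refine (hc.blockSuperadditive_meanBest hm).exists_tendsto (ℓ := fun _ => |m.top| + m.cost)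
    (C := ∑ s, |m.node s| + |m.top|) (fun _ => by positivity) ?_ ?_ (by positivity)
    (fun n hn k => m.meanBest_le hm hn k) hc0
  · exact tendsto_const_nhds.div_atTop (Real.tendsto_sqrt_atTop.comp tendsto_natCast_atTop_atTop)
  · exact fun n hn k => m.abs_meanBest_succ_sub_le hm (by linarith [le_abs_self m.top])
      (by linarith [neg_abs_le m.top]) (by omega) k

variable (m) in
/-- The limit of the mean optimal value per node, as a function of the edge density. -/
noncomputable def limitBest (c : ℝ) : ℝ :=
  limUnder atTop fun N : ℕ => m.meanBest N ⌊c * N⌋₊ / N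

theorem TensorConvex.tendsto_limitBest [NeZero q] (hc : m.TensorConvex)
    (hm : 0 ≤ m.cost) {c : ℝ} (hc0 : 0 ≤ c) :
    Tendsto (fun N : ℕ => m.meanBest N ⌊c * N⌋₊ / N) atTop (𝓝 (m.limitBest c)) :=
  tendsto_nhds_limUnder (hc.exists_tendsto_meanBest hm hc0)

theorem TensorConvex.lipschitzOnWith_limitBest [NeZero q] (hc : m.TensorConvex)
    (hm : 0 ≤ m.cost) {D : NNReal} (h1 : m.top ≤ D) (h2 : -D ≤ m.top - m.cost) :
    LipschitzOnWith D m.limitBest (Ioi 0) := by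
  refine LipschitzOnWith.of_dist_le_mul fun c hc0 c' hc0' => ?_
  have hc0 : 0 < c := hc0
  have hc0' : 0 < c' := hc0'
  rw [Real.dist_eq, Real.dist_eq]
  have hlim := ((hc.tendsto_limitBest hm hc0.le).sub (hc.tendsto_limitBest hm hc0'.le)).abs
  have hlim2 : Tendsto (fun N : ℕ => D * |c - c'| + D * 2 / (N : ℝ)) atTop
      (𝓝 (D * |c - c'| + 0)) :=
    tendsto_const_nhds.add (tendsto_const_nhds.div_atTop tendsto_natCast_atTop_atTop)
  rw [add_zero] at hlim2
  refine le_of_tendsto_of_tendsto hlim hlim2 ?_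
  filter_upwards [eventually_ge_atTop 1] with N hN
  have hN' : (0 : ℝ) < N := by exact_mod_cast hN
  rw [← sub_div, abs_div, abs_of_pos hN', div_le_iff₀ hN', add_mul, div_mul_cancel₀ _ hN'.ne']
  have h3 := abs_sub_le_of_abs_succ_sub_le
    (m.abs_meanBest_succ_sub_le hm h1 h2 hN) ⌊c * N⌋₊ ⌊c' * N⌋₊
  refine h3.trans ?_
  rw [mul_assoc, ← mul_add]
  refine mul_le_mul_of_nonneg_left ?_ D.coe_nonneg
  have h4 := abs_natFloor_sub_le (x := c * N) (by positivity)
  have h5 := abs_natFloor_sub_le (x := c' * N) (by positivity)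
  have h6 : |c * N - c' * N| = |c - c'| * N := by rw [← sub_mul, abs_mul, abs_of_pos hN']
  have h7 : (⌊c * N⌋₊ : ℝ) - ⌊c' * N⌋₊
      = (⌊c * N⌋₊ - c * N) + (c * N - c' * N) - (⌊c' * N⌋₊ - c' * N) := by ring
  rw [h7]
  refine (abs_sub _ _).trans ?_
  have h8 := abs_add_le ((⌊c * N⌋₊ : ℝ) - c * N) (c * N - c' * N)
  linarith

theorem TensorConvex.monotoneOn_limitBest [NeZero q] (hc : m.TensorConvex)
    (hm : 0 ≤ m.cost) (h : m.cost ≤ m.top) : MonotoneOn m.limitBest (Ioi 0) := by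
  intro c hc0 c' hc0' hcc
  refine le_of_tendsto_of_tendsto (hc.tendsto_limitBest hm (le_of_lt hc0))
    (hc.tendsto_limitBest hm (le_of_lt hc0')) ?_
  filter_upwards [eventually_ge_atTop 1] with N hN
  have hmono : Monotone (m.meanBest N) :=
    monotone_nat_of_le_succ fun M => by linarith [m.le_meanBest_succ hm hN M]
  exact div_le_div_of_nonneg_right (hmono (Nat.floor_mono
    (mul_le_mul_of_nonneg_right hcc (Nat.cast_nonneg N)))) (Nat.cast_nonneg N)

theorem TensorConvex.antitoneOn_limitBest [NeZero q] (hc : m.TensorConvex)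
    (hm : 0 ≤ m.cost) (h : m.top ≤ 0) : AntitoneOn m.limitBest (Ioi 0) := by
  intro c hc0 c' hc0' hcc
  refine le_of_tendsto_of_tendsto (hc.tendsto_limitBest hm (le_of_lt hc0'))
    (hc.tendsto_limitBest hm (le_of_lt hc0)) ?_
  filter_upwards [eventually_ge_atTop 1] with N hN
  have hanti : Antitone (m.meanBest N) :=
    antitone_nat_of_succ_le fun M => by linarith [m.meanBest_succ_le hm hN M]
  exact div_le_div_of_nonneg_right (hanti (Nat.floor_mono
    (mul_le_mul_of_nonneg_right hcc (Nat.cast_nonneg N)))) (Nat.cast_nonneg N)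

variable (m) in
/-- A satisfiable list remains satisfiable after adding a random hyperedge with probability at
least `δ / N`. -/
def Extendable (δ : ℝ) : Prop :=
  ∀ N, 2 ≤ N → ∀ L : List (HyperEdge K (Fin N)), m.Sat L →
    δ / N ≤ ∑ e, uniformWeight (HyperEdge K (Fin N)) e * m.satInd (e :: L)

theorem satInd_nonneg {V : Type} (L : List (HyperEdge K V)) : 0 ≤ m.satInd L := by
  unfold satInd; split_ifs <;> norm_num

theorem satInd_le_one {V : Type} (L : List (HyperEdge K V)) : m.satInd L ≤ 1 := by
  unfold satInd; split_ifs <;> norm_num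

theorem satInd_cons_le {V : Type} (e : HyperEdge K V) (L : List (HyperEdge K V)) :
    m.satInd (e :: L) ≤ m.satInd L := by
  by_cases h : m.Sat L
  · rw [show m.satInd L = 1 from if_pos h]; exact satInd_le_one _
  · have : ¬ m.Sat (e :: L) := fun ⟨x, hx⟩ =>
      h ⟨x, fun e' he' => hx e' (List.mem_cons_of_mem _ he')⟩
    rw [show m.satInd (e :: L) = 0 from if_neg this]; exact satInd_nonneg _

theorem satMean_succ_le {N : ℕ} (hN : 1 ≤ N) (M : ℕ) :
    m.satMean N (M + 1) ≤ m.satMean N M := by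
  unfold satMean
  rw [listMean_succ]
  refine listMean_mono (uniformWeight_nonneg _) fun L => ?_
  calc _ ≤ ∑ e, uniformWeight (HyperEdge K (Fin N)) e * m.satInd L :=
        Finset.sum_le_sum fun e _ => mul_le_mul_of_nonneg_left (satInd_cons_le e L)
          (uniformWeight_nonneg _ _)
    _ = _ := by rw [← Finset.sum_mul, sum_uniformWeight_hyperEdge hN, one_mul]

theorem satMean_zero [NeZero q] (N : ℕ) : m.satMean N 0 = 1 :=
  if_pos ⟨fun _ => 0, by simp⟩

theorem satMean_le_one [NeZero q] {N : ℕ} (hN : 1 ≤ N) (M : ℕ) : m.satMean N M ≤ 1 := by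
  rw [← m.satMean_zero N]
  exact antitone_nat_of_succ_le (fun M => satMean_succ_le hN M) (Nat.zero_le M)

theorem Extendable.le_satMean_succ {δ : ℝ} (h : m.Extendable δ) {N : ℕ} (hN : 2 ≤ N) (M : ℕ) :
    δ / N * m.satMean N M ≤ m.satMean N (M + 1) := by
  unfold satMean
  rw [listMean_succ, ← listMean_mul_left]
  refine listMean_mono (uniformWeight_nonneg _) fun L => ?_
  by_cases hL : m.Sat L
  · rw [show m.satInd L = 1 from if_pos hL, mul_one]; exact h N hN L hL
  · rw [show m.satInd L = 0 from if_neg hL, mul_zero]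
    exact Finset.sum_nonneg fun e _ => mul_nonneg (uniformWeight_nonneg _ _) (satInd_nonneg _)

theorem Extendable.satMean_pos [NeZero q] {δ : ℝ} (hδ : 0 < δ) (h : m.Extendable δ) {N : ℕ}
    (hN : 2 ≤ N) (M : ℕ) : 0 < m.satMean N M := by
  induction M with
  | zero => rw [satMean_zero]; exact one_pos
  | succ M ih =>
    have hN' : (0 : ℝ) < N := by exact_mod_cast (by omega : 0 < N)
    exact (mul_pos (div_pos hδ hN') ih).trans_le (h.le_satMean_succ hN M)

theorem Extendable.exists_tendsto_log_satMean [NeZero q] {δ : ℝ} (hδ : 0 < δ) (hδ1 : δ ≤ 1)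
    (h : m.Extendable δ) (hc : m.TensorConvex) {c : ℝ} (hc0 : 0 ≤ c) :
    ∃ r, Tendsto (fun N : ℕ => Real.log (m.satMean N ⌊c * N⌋₊) / N) atTop (𝓝 r) := by
  have hlogδ : Real.log δ ≤ 0 := Real.log_nonpos hδ.le hδ1
  refine (hc.blockSuperadditive_log_satMean fun N hN M => h.satMean_pos hδ hN M).exists_tendsto
    (ℓ := fun n => Real.log n - Real.log δ) (C := 0) ?_ ?_ ?_ le_rfl ?_ hc0
  · intro n
    linarith [Real.log_natCast_nonneg n]
  · have h1 : Tendsto (fun n : ℕ => Real.log n / √n) atTop (𝓝 0) := by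
      have := (isLittleO_log_rpow_atTop (show (0 : ℝ) < 1 / 2 by norm_num)).tendsto_div_nhds_zero
      simpa only [Real.sqrt_eq_rpow, Function.comp_def] using this.comp tendsto_natCast_atTop_atTop
    have h2 : Tendsto (fun n : ℕ => Real.log δ / √n) atTop (𝓝 0) :=
      tendsto_const_nhds.div_atTop (Real.tendsto_sqrt_atTop.comp tendsto_natCast_atTop_atTop)
    simpa only [sub_div, sub_zero] using h1.sub h2
  · intro n hn M
    have hn' : (0 : ℝ) < n := by exact_mod_cast (by omega : 0 < n)
    have hp := h.satMean_pos hδ hn M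
    have h1 := Real.log_le_log (mul_pos (div_pos hδ hn') hp) (h.le_satMean_succ hn M)
    rw [Real.log_mul (div_pos hδ hn').ne' hp.ne', Real.log_div hδ.ne' hn'.ne'] at h1
    have h2 := Real.log_le_log (h.satMean_pos hδ hn (M + 1))
      (m.satMean_succ_le (by omega : 1 ≤ n) M)
    rw [abs_le]
    constructor <;> linarith [Real.log_natCast_nonneg n]
  · intro n hn M
    rw [zero_mul]
    exact Real.log_nonpos
      (by
        rw [← listMean_const (sum_uniformWeight_hyperEdge (K := K) hn) M 0]
        exact listMean_mono (uniformWeight_nonneg _) fun L => satInd_nonneg L)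
      (satMean_le_one hn M)

end PenaltyModel

/-! ### Concentration and convergence in probability -/

open Classical in
theorem law_real_eq (K N M : ℕ) (P : List (HyperEdge K (Fin N)) → Prop) :
    (law K N M).real {G | P (List.ofFn G)}
      = listMean (uniformWeight (HyperEdge K (Fin N))) M (fun L => if P L then 1 else 0) := by
  have h := listMean_uniform (α := HyperEdge K (Fin N)) M (fun L => if P L then 1 else 0)
  have hcard : Fintype.card (MarkedHypergraph K N M)
      = Fintype.card (HyperEdge K (Fin N)) ^ M := by
    rw [Fintype.card_fun, Fintype.card_fin]
  unfold uniformWeight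
  rw [h, law, Measure.real, uniformOn_univ, Measure.count_apply_finite _ (Set.toFinite _),
    ENNReal.toReal_div, hcard, Finset.sum_boole, div_eq_inv_mul]
  simp

namespace PenaltyModel

variable {K q : ℕ} {m : PenaltyModel K q}

theorem abs_best_sub_le [NeZero q] (hm : 0 ≤ m.cost) {V : Type} [Fintype V]
    (L₁ L₂ : List (HyperEdge K V)) (e e' : HyperEdge K V) :
    |m.best (L₁ ++ e :: L₂) - m.best (L₁ ++ e' :: L₂)| ≤ m.cost := by
  have h1 := m.best_insert_le hm L₁ L₂ e
  have h2 := m.best_insert_le hm L₁ L₂ e'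
  have h3 := m.le_best_insert hm L₁ L₂ e
  have h4 := m.le_best_insert hm L₁ L₂ e'
  rw [abs_le]
  constructor <;> linarith

/-- Chebyshev's inequality with the Efron–Stein variance bound. -/
theorem law_real_abs_best_sub_le [NeZero q] (hm : 0 ≤ m.cost) {N : ℕ} (hN : 1 ≤ N) (M : ℕ)
    {t : ℝ} (ht : 0 < t) :
    (law K N M).real {G | t < |m.best (List.ofFn G) - m.meanBest N M|}
      ≤ M * m.cost ^ 2 / t ^ 2 := by
  classical
  rw [law_real_eq K N M fun L => t < |m.best L - m.meanBest N M|]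
  have hw1 := sum_uniformWeight_hyperEdge (K := K) hN
  have hvar : listMean (uniformWeight (HyperEdge K (Fin N))) M
      (fun L => (m.best L - m.meanBest N M) ^ 2) ≤ M * m.cost ^ 2 := by
    have h1 := listMean_sq_sub_mean hw1 M m.best
    have h2 := listMean_sq_le (uniformWeight_nonneg _) hw1
      (F := m.best) (fun L₁ L₂ e e' => m.abs_best_sub_le hm L₁ L₂ e e') M
    rw [meanBest, h1]
    linarith
  rw [div_eq_inv_mul]
  refine le_trans ?_ (mul_le_mul_of_nonneg_left hvar (by positivity))
  rw [← listMean_mul_left]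
  refine listMean_mono (uniformWeight_nonneg _) fun L => ?_
  split_ifs with h
  · rw [← div_eq_inv_mul, le_div_iff₀ (by positivity), one_mul, ← sq_abs (m.best L - _)]
    exact pow_le_pow_left₀ ht.le h.le 2
  · positivity

theorem TensorConvex.tendsto_law [NeZero q] (hc : m.TensorConvex) (hm : 0 ≤ m.cost) {c : ℝ}
    (hc0 : 0 ≤ c) {ε : ℝ} (hε : 0 < ε) :
    Tendsto (fun N : ℕ => (law K N ⌊c * N⌋₊).real
      {G | ε < |m.best (List.ofFn G) / N - m.limitBest c|}) atTop (𝓝 0) := by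
  have hbound : Tendsto (fun N : ℕ => 4 * c * m.cost ^ 2 / ε ^ 2 / (N : ℝ)) atTop (𝓝 0) :=
    tendsto_const_nhds.div_atTop tendsto_natCast_atTop_atTop
  refine tendsto_of_tendsto_of_tendsto_of_le_of_le' tendsto_const_nhds hbound
    (Eventually.of_forall fun N => measureReal_nonneg) ?_
  have hmean := Metric.tendsto_atTop.1 (hc.tendsto_limitBest hm hc0) (ε / 2) (half_pos hε)
  obtain ⟨N₀, hN₀⟩ := hmean
  filter_upwards [eventually_ge_atTop N₀, eventually_ge_atTop 1] with N hN hN1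
  have hN' : (0 : ℝ) < N := by exact_mod_cast hN1
  have hclose := hN₀ N hN
  rw [Real.dist_eq] at hclose
  set M := ⌊c * (N : ℝ)⌋₊ with hM
  have hsub : {G : MarkedHypergraph K N M | ε < |m.best (List.ofFn G) / N - m.limitBest c|}
      ⊆ {G | N * (ε / 2) < |m.best (List.ofFn G) - m.meanBest N M|} := by
    intro G hG
    have hG' : ε < |m.best (List.ofFn G) / N - m.limitBest c| := hG
    change N * (ε / 2) < |m.best (List.ofFn G) - m.meanBest N M|
    have h1 := abs_sub_le (m.best (List.ofFn G) / N) (m.meanBest N M / N) (m.limitBest c)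
    rw [← sub_div, abs_div, abs_of_pos hN'] at h1
    have h2 : ε / 2 < |m.best (List.ofFn G) - m.meanBest N M| / N := by linarith
    rw [lt_div_iff₀ hN'] at h2
    linarith
  have hMle : (M : ℝ) ≤ c * N := Nat.floor_le (by positivity)
  have : Nonempty (HyperEdge K (Fin N)) := ⟨(fun _ => ⟨0, hN1⟩, fun _ => 0)⟩
  have : IsProbabilityMeasure (law K N M) := by unfold law; infer_instance
  refine (measureReal_mono hsub).trans ((m.law_real_abs_best_sub_le hm hN1 M
    (by positivity)).trans ?_)
  calc M * m.cost ^ 2 / (N * (ε / 2)) ^ 2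
      ≤ (c * N) * m.cost ^ 2 / (N * (ε / 2)) ^ 2 := by gcongr
    _ = 4 * c * m.cost ^ 2 / ε ^ 2 / (N : ℝ) := by field_simp; ring

theorem TensorConvex.groundStateLimit [NeZero q] (hc : m.TensorConvex) (hm : 0 ≤ m.cost)
    {m' : Model K q}
    (h : ∀ N M (G : MarkedHypergraph K N M),
      groundState m' G = ((m.best (List.ofFn G) : ℝ) : EReal)) {c : ℝ} (hc0 : 0 ≤ c) :
    GroundStateLimit m' c (m.limitBest c) := by
  intro ε hε
  have hlim := ENNReal.tendsto_ofReal (hc.tendsto_law hm hc0 hε)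
  rw [ENNReal.ofReal_zero] at hlim
  refine hlim.congr' ?_
  filter_upwards [eventually_ge_atTop 1] with N hN1
  have : Nonempty (HyperEdge K (Fin N)) := ⟨(fun _ => ⟨0, hN1⟩, fun _ => 0)⟩
  have : IsProbabilityMeasure (law K N ⌊c * (N : ℝ)⌋₊) := by unfold law; infer_instance
  rw [ofReal_measureReal]
  congr 1
  ext G
  simp only [mem_ofPred_eq, h]
  have : (((m.best (List.ofFn G) : ℝ) : EReal) / (N : EReal) - (m.limitBest c : EReal)).abs
      = ENNReal.ofReal |m.best (List.ofFn G) / N - m.limitBest c| := by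
    rw [← EReal.abs_def, EReal.coe_sub, EReal.coe_div]
    rfl
  rw [this, ENNReal.ofReal_lt_ofReal_iff_of_nonneg hε.le]

end PenaltyModel

/-! ### From the models to penalty models -/

theorem EReal_coe_sum {ι : Type*} (s : Finset ι) (f : ι → ℝ) :
    ((∑ i ∈ s, f i : ℝ) : EReal) = ∑ i ∈ s, (f i : EReal) := by
  classical
  induction s using Finset.induction_on with
  | empty => simp
  | insert i s hi ih => rw [Finset.sum_insert hi, Finset.sum_insert hi, EReal.coe_add, ih]

namespace PenaltyModel

variable {K q : ℕ} {m : PenaltyModel K q}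

theorem value_ofFn {N M : ℕ} (G : MarkedHypergraph K N M) (x : Fin N → Fin q) :
    m.value (List.ofFn G) x = ∑ i, m.node (x i) + ∑ j, m.edgeValue (G j) x := by
  rw [value, List.map_ofFn, List.sum_ofFn]
  rfl

theorem coe_best [NeZero q] {V : Type} [Fintype V] (L : List (HyperEdge K V)) :
    ((m.best L : ℝ) : EReal) = ⨆ x, (m.value L x : EReal) := by
  apply le_antisymm
  · obtain ⟨x, hx⟩ := m.exists_value_eq_best L
    rw [← hx]
    exact le_iSup (fun x => (m.value L x : EReal)) x
  · exact iSup_le fun x => EReal.coe_le_coe_iff.2 (value_le_best L x)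

/-- A model with real edge potentials taking two values is a penalty model. -/
theorem groundState_eq_best [NeZero q] {m' : Model K q} (hnode : m'.node = m.node)
    (hgood : ∀ a y, ¬ m.bad a y → m'.edge a y = (m.top : EReal))
    (hbad : ∀ a y, m.bad a y → m'.edge a y = ((m.top - m.cost : ℝ) : EReal))
    {N M : ℕ} (G : MarkedHypergraph K N M) :
    groundState m' G = ((m.best (List.ofFn G) : ℝ) : EReal) := by
  rw [coe_best]
  refine iSup_congr fun x => ?_
  rw [value_ofFn, EReal.coe_add, EReal_coe_sum, EReal_coe_sum, energy, hnode]
  congr 1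
  refine Finset.sum_congr rfl fun j _ => ?_
  unfold edgeValue
  by_cases h : m.Viol (G j) x
  · rw [if_pos h, mul_one]; exact hbad _ _ h
  · rw [if_neg h, mul_zero, sub_zero]; exact hgood _ _ h

theorem value_eq_length_iff {V : Type} [Fintype V] (hnode : m.node = fun _ => 0)
    (htop : m.top = 1) (hcost : m.cost = 1) (L : List (HyperEdge K V)) (x : V → Fin q) :
    m.value L x ≤ L.length ∧ (m.value L x = L.length ↔ ∀ e ∈ L, ¬ m.Viol e x) := by
  induction L with
  | nil => simp [value, hnode]
  | cons e L ih =>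
    have h1 := m.value_insert [] L e x
    simp only [List.nil_append] at h1
    rw [h1, edgeValue, htop, hcost, List.forall_mem_cons, List.length_cons]
    push_cast
    by_cases h : m.Viol e x
    · rw [if_pos h]
      refine ⟨by linarith [ih.1], ⟨fun h' => ?_, fun h' => absurd h h'.1⟩⟩
      linarith [ih.1]
    · rw [if_neg h]
      refine ⟨by linarith [ih.1], ⟨fun h' => ⟨h, ih.2.1 (by linarith)⟩, fun h' => ?_⟩⟩
      linarith [ih.2.2 h'.2]

theorem satProb_eq_satMean [NeZero q] {m' : Model K q}
    (h : ∀ N M (G : MarkedHypergraph K N M),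
      groundState m' G = ((m.best (List.ofFn G) : ℝ) : EReal))
    (hnode : m.node = fun _ => 0) (htop : m.top = 1) (hcost : m.cost = 1) (N M : ℕ) :
    satProb m' N M = m.satMean N M := by
  have hset : {G : MarkedHypergraph K N M | groundState m' G = (M : EReal)}
      = {G | m.Sat (List.ofFn G)} := by
    ext G
    have hcoe : ((M : ℕ) : EReal) = ((M : ℝ) : EReal) := rfl
    simp only [mem_ofPred_eq, h, hcoe, EReal.coe_eq_coe_iff]
    have hv := value_eq_length_iff hnode htop hcost (List.ofFn G)
    simp only [List.length_ofFn] at hv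
    constructor
    · intro hbest
      obtain ⟨x, hx⟩ := m.exists_value_eq_best (List.ofFn G)
      exact ⟨x, (hv x).2.1 (hx.trans hbest)⟩
    · rintro ⟨x, hx⟩
      obtain ⟨x', hx'⟩ := m.exists_value_eq_best (List.ofFn G)
      refine le_antisymm (hx' ▸ (hv x').1) ?_
      rw [← (hv x).2.2 hx]
      exact value_le_best _ _
  rw [satProb, hset, law_real_eq K N M m.Sat]
  rfl

theorem TensorConvex.satRateLimit [NeZero q] (hc : m.TensorConvex) {δ : ℝ} (hδ : 0 < δ)
    (hδ1 : δ ≤ 1) (hext : m.Extendable δ) {m' : Model K q}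
    (h : ∀ N M (G : MarkedHypergraph K N M),
      groundState m' G = ((m.best (List.ofFn G) : ℝ) : EReal))
    (hnode : m.node = fun _ => 0) (htop : m.top = 1) (hcost : m.cost = 1) {c : ℝ}
    (hc0 : 0 ≤ c) : ∃ r, SatRateLimit m' c r := by
  obtain ⟨r, hr⟩ := hext.exists_tendsto_log_satMean hδ hδ1 hc hc0
  refine ⟨r, ?_, ?_⟩
  · filter_upwards [eventually_ge_atTop 2] with N hN
    rw [satProb_eq_satMean h hnode htop hcost]
    exact hext.satMean_pos hδ hN _
  · simpa only [satProb_eq_satMean h hnode htop hcost] using hr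

end PenaltyModel

/-! ### The six models as penalty models, and their convexity -/

/-- The models on pairs in which equal values at the two ends of an edge are penalised. -/
def pairModel {q : ℕ} (node : Fin q → ℝ) (top cost : ℝ) : PenaltyModel 2 q where
  node := node
  top := top
  cost := cost
  bad _ y := y 0 = y 1

/-- Independent sets with the potential `-∞` of a violated edge replaced by `-1`, which does not
change the ground state. -/
noncomputable def softIndependentSet : PenaltyModel 2 2 where
  node s := if s = 1 then 1 else 0
  top := 0
  cost := 1
  bad _ y := y 0 = 1 ∧ y 1 = 1

/-- K-SAT as a penalty model. -/
def kSatPenalty (K : ℕ) : PenaltyModel K 2 where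
  node _ := 0
  top := 1
  cost := 1
  bad a y := y = a

/-- NAE-K-SAT as a penalty model. -/
def naeKSatPenalty (K : ℕ) : PenaltyModel K 2 where
  node _ := 0
  top := 1
  cost := 1
  bad a y := y = a ∨ y = (fun j => 1 - a j)

/-- Lying in a common class is a sum of tensor powers of class indicators. -/
theorem sum_prod_class {K : ℕ} {V T : Type} [Fintype T] [DecidableEq T] (τ : V → T)
    (e : Fin K → V) (k₀ : Fin K) [Decidable (∀ k, τ (e k) = τ (e k₀))] :
    ∑ t, ∏ k, (if τ (e k) = t then (1 : ℝ) else 0)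
      = if ∀ k, τ (e k) = τ (e k₀) then 1 else 0 := by
  simp only [Finset.prod_ite_zero, Finset.prod_const_one, Finset.mem_univ, true_implies]
  rw [Finset.sum_eq_single (τ (e k₀))]
  · congr 1
  · intro t _ ht
    rw [if_neg]
    exact fun h => ht (h k₀).symm
  · simp

theorem tensorConvex_pairModel {q : ℕ} (node : Fin q → ℝ) (top cost : ℝ) :
    (pairModel node top cost).TensorConvex := by
  classical
  intro V _ S _
  have : Fintype (S → Fin q) := Fintype.ofFinite _
  let τ : V → S → Fin q := fun v x => x.1 v
  refine ⟨(Fin 2 → Fin 2) × (S → Fin q), inferInstance, fun i v => if τ v = i.2 then 1 else 0,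
    fun i v => by positivity, fun e => ?_⟩
  rw [Fintype.sum_prod_type]
  refine Finset.sum_congr rfl fun a _ => ?_
  refine Eq.trans ?_ (sum_prod_class τ e 0).symm
  unfold PenaltyModel.allViol
  congr 1
  simp only [PenaltyModel.Viol, pairModel, Fin.forall_fin_two, τ, funext_iff,
    Subtype.forall, eq_iff_iff]
  exact ⟨fun h => ⟨fun _ _ => trivial, fun x hx => (h x hx).symm⟩, fun h x hx => (h.2 x hx).symm⟩

theorem tensorConvex_softIndependentSet : softIndependentSet.TensorConvex := by
  classical
  intro V _ S _
  refine ⟨Fin 2 → Fin 2, inferInstance, fun _ v => if ∀ x ∈ S, x v = 1 then 1 else 0,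
    fun i v => by positivity, fun e => ?_⟩
  refine Finset.sum_congr rfl fun a _ => ?_
  simp only [Finset.prod_ite_zero, Finset.prod_const_one, Finset.mem_univ, true_implies]
  unfold PenaltyModel.allViol
  congr 1
  simp only [PenaltyModel.Viol, softIndependentSet, Fin.forall_fin_two, eq_iff_iff]
  exact forall₂_and

theorem tensorConvex_kSatPenalty (K : ℕ) : (kSatPenalty K).TensorConvex := by
  classical
  intro V _ S _
  refine ⟨Unit, inferInstance, fun _ v => ∑ s : Fin 2, if ∀ x ∈ S, x v = s then 1 else 0,
    fun i v => by positivity, fun e => ?_⟩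
  rw [Fintype.sum_unique (ι := Unit), Finset.prod_univ_sum, Fintype.piFinset_univ]
  refine Finset.sum_congr rfl fun a _ => ?_
  simp only [Finset.prod_ite_zero, Finset.prod_const_one, Finset.mem_univ, true_implies]
  unfold PenaltyModel.allViol
  congr 1
  simp only [PenaltyModel.Viol, kSatPenalty, funext_iff, eq_iff_iff]
  exact ⟨fun h k x hx => h x hx k, fun h x hx k => h k x hx⟩

theorem eq_one_sub_iff (s t : Fin 2) : s = 1 - t ↔ s ≠ t := by decide +revert

/-- Two nodes are in the same class if all assignments in `S` agree or disagree with a fixed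
`x₀ ∈ S` on both; a tuple of nodes in one class is violated by all of `S` for exactly two marks. -/
theorem tensorConvex_naeKSatPenalty {K : ℕ} (hK : 1 ≤ K) : (naeKSatPenalty K).TensorConvex := by
  classical
  intro V _ S ⟨x₀, hx₀⟩
  have : Fintype (S → Prop) := Fintype.ofFinite _
  let k₀ : Fin K := ⟨0, hK⟩
  let τ : V → S → Prop := fun v x => x.1 v = x₀ v
  refine ⟨Bool × (S → Prop), inferInstance, fun i v => if τ v = i.2 then 1 else 0,
    fun i v => by positivity, fun e => ?_⟩
  set y : Fin K → Fin 2 := fun k => x₀ (e k) with hy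
  set y' : Fin K → Fin 2 := fun k => 1 - x₀ (e k) with hy'
  have hyy' : y ≠ y' := fun h => absurd (congrFun h k₀) (by
    simp only [hy, hy']; exact fun h => (eq_one_sub_iff _ _).1 h rfl)
  set C : Prop := ∀ k, τ (e k) = τ (e k₀) with hC
  have hclass : C ↔ ∀ x ∈ S, (∀ k, x (e k) = x₀ (e k)) ∨ ∀ k, x (e k) ≠ x₀ (e k) := by
    simp only [hC, τ, funext_iff, Subtype.forall, eq_iff_iff]
    constructor
    · intro h x hx
      by_cases h0 : x (e k₀) = x₀ (e k₀)
      · exact Or.inl fun k => (h k x hx).2 h0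
      · exact Or.inr fun k hk => h0 ((h k x hx).1 hk)
    · intro h k x hx
      rcases h x hx with h | h
      · exact ⟨fun _ => h k₀, fun _ => h k⟩
      · exact ⟨fun h' => absurd h' (h k), fun h' => absurd h' (h k₀)⟩
  have hviol : ∀ (a : Fin K → Fin 2) (x : V → Fin 2), (naeKSatPenalty K).Viol (e, a) x ↔
      (∀ k, x (e k) = a k) ∨ ∀ k, x (e k) ≠ a k := by
    intro a x
    simp only [PenaltyModel.Viol, naeKSatPenalty, funext_iff, eq_one_sub_iff]
  have hne : ∀ s t : Fin 2, s ≠ 1 - t ↔ s = t := by decide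
  have hiff : ∀ a, (∀ x ∈ S, (naeKSatPenalty K).Viol (e, a) x) ↔ (a = y ∨ a = y') ∧ C := by
    intro a
    simp only [hviol]
    constructor
    · intro h
      have ha : a = y ∨ a = y' := by
        rcases h x₀ hx₀ with h | h
        · exact Or.inl (funext fun k => (h k).symm)
        · exact Or.inr (funext fun k => (eq_one_sub_iff _ _).2 (h k).symm)
      refine ⟨ha, hclass.2 fun x hx => ?_⟩
      rcases ha with rfl | rfl
      · exact h x hx
      · simpa only [hy', eq_one_sub_iff, hne, or_comm, ne_eq, not_not] using h x hx
    · rintro ⟨rfl | rfl, hC⟩ x hx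
      · exact hclass.1 hC x hx
      · simpa only [hy', eq_one_sub_iff, hne, or_comm, ne_eq, not_not] using hclass.1 hC x hx
  have hterm : ∀ a, (naeKSatPenalty K).allViol S (e, a)
      = (if a = y then if C then 1 else 0 else 0) + if a = y' then if C then 1 else 0 else 0 := by
    intro a
    unfold PenaltyModel.allViol
    simp only [hiff]
    by_cases h1 : a = y
    · simp [h1, hyy']
    · simp [h1, ite_and]
  simp only [hterm, Finset.sum_add_distrib, Finset.sum_ite_eq', Finset.mem_univ, if_true]
  rw [Fintype.sum_prod_type, Fintype.sum_bool]
  exact congrArg₂ (· + ·) (sum_prod_class τ e k₀).symm (sum_prod_class τ e k₀).symm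

/-! ### Adding a hyperedge to a satisfiable instance -/

namespace PenaltyModel

variable {K q : ℕ} {m : PenaltyModel K q}

theorem le_sum_satInd {N : ℕ} {L : List (HyperEdge K (Fin N))} {x : Fin N → Fin q}
    (hx : ∀ e ∈ L, ¬ m.Viol e x) {ι : Type} [Fintype ι] {φ : ι → HyperEdge K (Fin N)}
    (hφ : Function.Injective φ) (hgood : ∀ i, ¬ m.Viol (φ i) x) :
    (Fintype.card ι : ℝ) / (N ^ K * 2 ^ K)
      ≤ ∑ e, uniformWeight (HyperEdge K (Fin N)) e * m.satInd (e :: L) := by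
  classical
  have hcard : (Fintype.card (HyperEdge K (Fin N)) : ℝ) = N ^ K * 2 ^ K := by simp
  calc (Fintype.card ι : ℝ) / (N ^ K * 2 ^ K)
      = ∑ i : ι, uniformWeight (HyperEdge K (Fin N)) (φ i) := by
        simp only [uniformWeight, hcard, Finset.sum_const, Finset.card_univ, nsmul_eq_mul]
        rw [div_eq_mul_inv]
    _ = ∑ i : ι, uniformWeight (HyperEdge K (Fin N)) (φ i) * m.satInd (φ i :: L) := by
        refine Finset.sum_congr rfl fun i _ => ?_
        have : m.Sat (φ i :: L) := ⟨x, List.forall_mem_cons.2 ⟨hgood i, hx⟩⟩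
        rw [show m.satInd (φ i :: L) = 1 from if_pos this, mul_one]
    _ = ∑ e ∈ Finset.univ.map ⟨φ, hφ⟩,
          uniformWeight (HyperEdge K (Fin N)) e * m.satInd (e :: L) := by
        rw [Finset.sum_map]; rfl
    _ ≤ _ := Finset.sum_le_sum_of_subset_of_nonneg (Finset.subset_univ _) fun e _ _ =>
        mul_nonneg (uniformWeight_nonneg _ _) (satInd_nonneg _)

theorem extendable_of_exists_mark (h : ∀ y, ∃ a, ¬ m.bad a y) :
    m.Extendable ((2 : ℝ) ^ K)⁻¹ := by
  rintro N hN L ⟨x, hx⟩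
  have hN' : (1 : ℝ) ≤ N := by exact_mod_cast (by omega : 1 ≤ N)
  have hN0 : (0 : ℝ) < N := by linarith
  choose a ha using fun e : Fin K → Fin N => h fun k => x (e k)
  have key := m.le_sum_satInd hx (φ := fun e => (e, a e))
    (fun e e' h => (Prod.mk.inj h).1) (fun e => ha e)
  refine le_trans ?_ key
  have : (Fintype.card (Fin K → Fin N) : ℝ) / (N ^ K * 2 ^ K) = ((2 : ℝ) ^ K)⁻¹ := by
    simp only [Fintype.card_fun, Fintype.card_fin]
    push_cast
    field_simp
  rw [this]
  exact div_le_self (by positivity) hN'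

end PenaltyModel

/-- A satisfiable instance has a nonconstant satisfying assignment `x`; if `x u ≠ x v`, then each
node differs from `u` or from `v`. -/
theorem extendable_pairModel {q : ℕ} (hq : 2 ≤ q) (node : Fin q → ℝ) (top cost : ℝ) :
    (pairModel node top cost).Extendable 1 := by
  classical
  rintro N hN L ⟨x, hx⟩
  obtain ⟨x, hx, u, v, huv⟩ : ∃ x : Fin N → Fin q,
      (∀ e ∈ L, ¬ (pairModel node top cost).Viol e x) ∧ ∃ u v, x u ≠ x v := by
    cases L with
    | nil =>
      refine ⟨fun v => if v = ⟨0, by omega⟩ then ⟨0, by omega⟩ else ⟨1, by omega⟩, by simp,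
        ⟨0, by omega⟩, ⟨1, by omega⟩, by simp⟩
    | cons e L => exact ⟨x, hx, e.1 0, e.1 1, hx e List.mem_cons_self⟩
  have key := (pairModel node top cost).le_sum_satInd hx
    (φ := fun i : Fin N × (Fin 2 → Fin 2) => (![i.1, if x i.1 = x u then v else u], i.2)) ?_ ?_
  · refine le_trans (le_of_eq ?_) key
    have hN0 : (0 : ℝ) < N := by exact_mod_cast (by omega : 0 < N)
    simp only [Fintype.card_prod, Fintype.card_fun, Fintype.card_fin]
    push_cast
    field_simp
    norm_num
  · rintro ⟨w, a⟩ ⟨w', a'⟩ h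
    obtain ⟨h1, h2⟩ := Prod.mk.inj h
    exact Prod.ext (congrFun h1 0) h2
  · rintro ⟨w, a⟩ h
    have h' : x w = x (if x w = x u then v else u) := h
    split_ifs at h' with h1
    · exact huv (h1.symm.trans h')
    · exact h1 h'

/-! ### Independent sets -/

/-- Deleting a node from each violated edge turns any set into an independent one without loss:
every step costs one node and removes at least one violation. -/
theorem exists_independent_value_ge {V : Type} [Fintype V] (L : List (HyperEdge 2 V))
    (x : V → Fin 2) :
    ∃ x', (∀ e ∈ L, ¬ softIndependentSet.Viol e x') ∧
      softIndependentSet.value L x ≤ softIndependentSet.value L x' := by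
  classical
  induction hs : (Finset.univ.filter fun v => x v = 1).card using Nat.strong_induction_on
    generalizing x with
  | _ s ih =>
    by_cases hgood : ∀ e ∈ L, ¬ softIndependentSet.Viol e x
    · exact ⟨x, hgood, le_rfl⟩
    push Not at hgood
    obtain ⟨e, he, hviol⟩ := hgood
    have hu : x (e.1 0) = 1 := hviol.1
    set u := e.1 0 with hudef
    set x₁ := Function.update x u 0 with hx₁
    have hle : ∀ v, x₁ v = 1 → x v = 1 := by
      intro v hv
      by_cases h : v = u
      · rw [h]; exact hu
      · rwa [hx₁, Function.update_of_ne h] at hv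
    have hlt : (Finset.univ.filter fun v => x₁ v = 1).card < s := by
      rw [← hs]
      refine Finset.card_lt_card (Finset.ssubset_iff_of_subset ?_ |>.2 ⟨u, ?_, ?_⟩)
      · intro v hv
        simp only [Finset.mem_filter, Finset.mem_univ, true_and] at hv ⊢
        exact hle v hv
      · simpa using hu
      · simp [hx₁]
    obtain ⟨x', h1, h2⟩ := ih _ hlt x₁ rfl
    refine ⟨x', h1, le_trans ?_ h2⟩
    have hnode : ∑ v, softIndependentSet.node (x v)
        = ∑ v, softIndependentSet.node (x₁ v) + 1 := by
      rw [← Finset.add_sum_erase _ _ (Finset.mem_univ u),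
        ← Finset.add_sum_erase (a := u) _ (fun v => softIndependentSet.node (x₁ v))
          (Finset.mem_univ u)]
      have : ∑ v ∈ Finset.univ.erase u, softIndependentSet.node (x₁ v)
          = ∑ v ∈ Finset.univ.erase u, softIndependentSet.node (x v) :=
        Finset.sum_congr rfl fun v hv => by
          rw [hx₁, Function.update_of_ne (Finset.ne_of_mem_erase hv)]
      rw [this]
      simp [softIndependentSet, hx₁, hu]
      ring
    have hmono : ∀ e', softIndependentSet.edgeValue e' x ≤ softIndependentSet.edgeValue e' x₁ := by
      intro e'
      unfold PenaltyModel.edgeValue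
      by_cases h : softIndependentSet.Viol e' x₁
      · have : softIndependentSet.Viol e' x := ⟨hle _ h.1, hle _ h.2⟩
        rw [if_pos h, if_pos this]
      · rw [if_neg h]
        split_ifs <;> simp [softIndependentSet]
    have hedge : softIndependentSet.edgeValue e x + 1 = softIndependentSet.edgeValue e x₁ := by
      unfold PenaltyModel.edgeValue
      have : ¬ softIndependentSet.Viol e x₁ := by
        rintro ⟨h, -⟩
        have h' : x₁ u = 1 := h
        simp [hx₁] at h'
      rw [if_pos hviol, if_neg this]
      simp [softIndependentSet]
    obtain ⟨L₁, L₂, rfl⟩ := List.append_of_mem he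
    have hrest : ((L₁ ++ L₂).map fun e => softIndependentSet.edgeValue e x).sum
        ≤ ((L₁ ++ L₂).map fun e => softIndependentSet.edgeValue e x₁).sum :=
      List.sum_le_sum fun e' _ => hmono e'
    rw [PenaltyModel.value_insert, PenaltyModel.value_insert, ← hedge]
    unfold PenaltyModel.value
    linarith

theorem groundState_independentSet {N M : ℕ} (G : MarkedHypergraph 2 N M) :
    groundState independentSet G = ((softIndependentSet.best (List.ofFn G) : ℝ) : EReal) := by
  have henergy : ∀ x : Fin N → Fin 2,
      (∀ e ∈ List.ofFn G, ¬ softIndependentSet.Viol e x) →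
      energy independentSet G x = (softIndependentSet.value (List.ofFn G) x : EReal) := by
    intro x hx
    rw [PenaltyModel.value_ofFn, EReal.coe_add, EReal_coe_sum, EReal_coe_sum, energy]
    congr 1
    refine Finset.sum_congr rfl fun j _ => ?_
    have h := hx (G j) (List.mem_ofFn.2 ⟨j, rfl⟩)
    unfold PenaltyModel.edgeValue
    rw [if_neg h, mul_zero, sub_zero]
    exact if_neg h
  rw [PenaltyModel.coe_best]
  apply le_antisymm
  · refine iSup_le fun x => ?_
    by_cases hx : ∀ e ∈ List.ofFn G, ¬ softIndependentSet.Viol e x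
    · rw [henergy x hx]
      exact le_iSup (fun x => (softIndependentSet.value (List.ofFn G) x : EReal)) x
    · push Not at hx
      obtain ⟨e, he, hviol⟩ := hx
      obtain ⟨j, rfl⟩ := List.mem_ofFn.1 he
      have hbot : independentSet.edge (G j).2 (fun k => x ((G j).1 k)) = ⊥ := if_pos hviol
      rw [energy, ← Finset.add_sum_erase _ _ (Finset.mem_univ j), hbot, EReal.bot_add,
        EReal.add_bot]
      exact bot_le
  · refine iSup_le fun x => ?_
    obtain ⟨x', h1, h2⟩ := exists_independent_value_ge (List.ofFn G) x
    refine (EReal.coe_le_coe_iff.2 h2).trans ?_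
    rw [← henergy x' h1]
    exact le_iSup (fun x => energy independentSet G x) x'

/-! ### Ground states of the remaining models -/

theorem groundState_maxCut {N M : ℕ} (G : MarkedHypergraph 2 N M) :
    groundState maxCut G
      = (((pairModel (fun _ : Fin 2 => 0) 1 1).best (List.ofFn G) : ℝ) : EReal) :=
  PenaltyModel.groundState_eq_best rfl (fun _ _ h => (if_neg h).trans (by simp [pairModel]))
    (fun _ _ h => (if_pos h).trans (by simp [pairModel])) G

theorem groundState_ising (β B : ℝ) {N M : ℕ} (G : MarkedHypergraph 2 N M) :
    groundState (ising β B) G = (((pairModel (fun s : Fin 2 => if s = 0 then -B else B) β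
      (2 * β)).best (List.ofFn G) : ℝ) : EReal) :=
  PenaltyModel.groundState_eq_best rfl (fun _ _ h => (if_neg h).trans rfl)
    (fun _ _ h => (if_pos h).trans (congrArg _ (by simp only [pairModel]; ring))) G

theorem groundState_coloring (q : ℕ) [NeZero q] {N M : ℕ} (G : MarkedHypergraph 2 N M) :
    groundState (coloring q) G
      = (((pairModel (fun _ : Fin q => 0) 1 1).best (List.ofFn G) : ℝ) : EReal) :=
  PenaltyModel.groundState_eq_best rfl (fun _ _ h => (if_neg h).trans (by simp [pairModel]))
    (fun _ _ h => (if_pos h).trans (by simp [pairModel])) G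

theorem groundState_kSat (K : ℕ) {N M : ℕ} (G : MarkedHypergraph K N M) :
    groundState (kSat K) G = (((kSatPenalty K).best (List.ofFn G) : ℝ) : EReal) :=
  PenaltyModel.groundState_eq_best rfl (fun _ _ h => (if_neg h).trans (by simp [kSatPenalty]))
    (fun _ _ h => (if_pos h).trans (by simp [kSatPenalty])) G

theorem groundState_naeKSat (K : ℕ) {N M : ℕ} (G : MarkedHypergraph K N M) :
    groundState (naeKSat K) G = (((naeKSatPenalty K).best (List.ofFn G) : ℝ) : EReal) :=
  PenaltyModel.groundState_eq_best rfl (fun _ _ h => (if_neg h).trans (by simp [naeKSatPenalty]))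
    (fun _ _ h => (if_pos h).trans (by simp [naeKSatPenalty])) G

theorem exists_not_bad_kSatPenalty {K : ℕ} (hK : 1 ≤ K) (y : Fin K → Fin 2) :
    ∃ a, ¬ (kSatPenalty K).bad a y :=
  ⟨fun k => 1 - y k, fun h => (eq_one_sub_iff _ _).1 (congrFun h ⟨0, hK⟩) rfl⟩

theorem exists_not_bad_naeKSatPenalty {K : ℕ} (hK : 2 ≤ K) (y : Fin K → Fin 2) :
    ∃ a, ¬ (naeKSatPenalty K).bad a y := by
  refine ⟨Function.update y ⟨0, by omega⟩ (1 - y ⟨0, by omega⟩), ?_⟩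
  rintro (h | h)
  · have h0 := congrFun h ⟨0, by omega⟩
    rw [Function.update_self] at h0
    exact (eq_one_sub_iff _ _).1 h0 rfl
  · have h1 := congrFun h ⟨1, by omega⟩
    rw [Function.update_of_ne (by simp)] at h1
    exact (eq_one_sub_iff _ _).1 h1 rfl

end DilutedSpin

theorem theorem1 :
    -- Independent set
    (∃ H : ℝ → ℝ,
      (∀ c : ℝ, 0 < c → DilutedSpin.GroundStateLimit DilutedSpin.independentSet c (H c)) ∧
      LipschitzOnWith 1 H (Set.Ioi 0) ∧ AntitoneOn H (Set.Ioi 0)) ∧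
    -- MAX-CUT
    (∃ H : ℝ → ℝ,
      (∀ c : ℝ, 0 < c → DilutedSpin.GroundStateLimit DilutedSpin.maxCut c (H c)) ∧
      LipschitzOnWith 1 H (Set.Ioi 0) ∧ MonotoneOn H (Set.Ioi 0)) ∧
    -- anti-ferromagnetic Ising model
    (∀ β B : ℝ, 0 < β → ∃ H : ℝ → ℝ,
      (∀ c : ℝ, 0 < c → DilutedSpin.GroundStateLimit (DilutedSpin.ising β B) c (H c)) ∧
      LipschitzOnWith β.toNNReal H (Set.Ioi 0)) ∧
    -- Coloring
    (∀ q : ℕ, 1 ≤ q → ∃ H : ℝ → ℝ,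
      (∀ c : ℝ, 0 < c → DilutedSpin.GroundStateLimit (DilutedSpin.coloring q) c (H c)) ∧
      LipschitzOnWith 1 H (Set.Ioi 0) ∧ MonotoneOn H (Set.Ioi 0)) ∧
    -- K-SAT
    (∀ K : ℕ, 2 ≤ K → ∃ H : ℝ → ℝ,
      (∀ c : ℝ, 0 < c → DilutedSpin.GroundStateLimit (DilutedSpin.kSat K) c (H c)) ∧
      LipschitzOnWith 1 H (Set.Ioi 0) ∧ MonotoneOn H (Set.Ioi 0)) ∧
    -- NAE-K-SAT
    (∀ K : ℕ, 2 ≤ K → ∃ H : ℝ → ℝ,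
      (∀ c : ℝ, 0 < c → DilutedSpin.GroundStateLimit (DilutedSpin.naeKSat K) c (H c)) ∧
      LipschitzOnWith 1 H (Set.Ioi 0) ∧ MonotoneOn H (Set.Ioi 0)) ∧
    -- exponential rate of the satisfiability probability
    (∀ q : ℕ, 2 ≤ q → ∀ c : ℝ, 0 < c →
      ∃ r : ℝ, DilutedSpin.SatRateLimit (DilutedSpin.coloring q) c r) ∧
    (∀ K : ℕ, 2 ≤ K → ∀ c : ℝ, 0 < c →
      ∃ r : ℝ, DilutedSpin.SatRateLimit (DilutedSpin.kSat K) c r) ∧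
    (∀ K : ℕ, 2 ≤ K → ∀ c : ℝ, 0 < c →
      ∃ r : ℝ, DilutedSpin.SatRateLimit (DilutedSpin.naeKSat K) c r) := by
  open DilutedSpin in
  have hpair : ∀ {q : ℕ} (node : Fin q → ℝ) (top cost : ℝ),
      (pairModel node top cost).TensorConvex := tensorConvex_pairModel
  refine ⟨?_, ?_, ?_, ?_, ?_, ?_, ?_, ?_, ?_⟩
  · have hc := DilutedSpin.tensorConvex_softIndependentSet
    have hm : 0 ≤ DilutedSpin.softIndependentSet.cost := zero_le_one
    exact ⟨_, fun c hc0 => hc.groundStateLimit hm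
      (fun _ _ G => DilutedSpin.groundState_independentSet G) hc0.le,
      hc.lipschitzOnWith_limitBest hm (by simp [DilutedSpin.softIndependentSet])
        (by simp [DilutedSpin.softIndependentSet]), hc.antitoneOn_limitBest hm le_rfl⟩
  · have hc := hpair (fun _ : Fin 2 => 0) 1 1
    exact ⟨_, fun c hc0 => hc.groundStateLimit zero_le_one
      (fun _ _ G => DilutedSpin.groundState_maxCut G) hc0.le,
      hc.lipschitzOnWith_limitBest zero_le_one (by simp [DilutedSpin.pairModel])
        (by simp [DilutedSpin.pairModel]), hc.monotoneOn_limitBest zero_le_one le_rfl⟩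
  · intro β B hβ
    have hc := hpair (fun s : Fin 2 => if s = 0 then -B else B) β (2 * β)
    have hm : 0 ≤ 2 * β := by positivity
    refine ⟨_, fun c hc0 => hc.groundStateLimit hm
      (fun _ _ G => DilutedSpin.groundState_ising β B G) hc0.le,
      hc.lipschitzOnWith_limitBest hm ?_ ?_⟩
    · rw [Real.coe_toNNReal _ hβ.le]; exact le_rfl
    · rw [Real.coe_toNNReal _ hβ.le]; simp only [DilutedSpin.pairModel]; linarith
  · intro q hq
    have : NeZero q := ⟨by omega⟩
    have hc := hpair (fun _ : Fin q => 0) 1 1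
    exact ⟨_, fun c hc0 => hc.groundStateLimit zero_le_one
      (fun _ _ G => DilutedSpin.groundState_coloring q G) hc0.le,
      hc.lipschitzOnWith_limitBest zero_le_one (by simp [DilutedSpin.pairModel])
        (by simp [DilutedSpin.pairModel]), hc.monotoneOn_limitBest zero_le_one le_rfl⟩
  · intro K hK
    have hc := DilutedSpin.tensorConvex_kSatPenalty K
    exact ⟨_, fun c hc0 => hc.groundStateLimit zero_le_one
      (fun _ _ G => DilutedSpin.groundState_kSat K G) hc0.le,
      hc.lipschitzOnWith_limitBest zero_le_one (by simp [DilutedSpin.kSatPenalty])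
        (by simp [DilutedSpin.kSatPenalty]), hc.monotoneOn_limitBest zero_le_one le_rfl⟩
  · intro K hK
    have hc := DilutedSpin.tensorConvex_naeKSatPenalty (by omega : 1 ≤ K)
    exact ⟨_, fun c hc0 => hc.groundStateLimit zero_le_one
      (fun _ _ G => DilutedSpin.groundState_naeKSat K G) hc0.le,
      hc.lipschitzOnWith_limitBest zero_le_one (by simp [DilutedSpin.naeKSatPenalty])
        (by simp [DilutedSpin.naeKSatPenalty]), hc.monotoneOn_limitBest zero_le_one le_rfl⟩
  · intro q hq c hc0
    have : NeZero q := ⟨by omega⟩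
    exact (hpair (fun _ : Fin q => 0) 1 1).satRateLimit one_pos le_rfl
      (DilutedSpin.extendable_pairModel hq _ _ _)
      (fun _ _ G => DilutedSpin.groundState_coloring q G) rfl rfl rfl hc0.le
  · intro K hK c hc0
    exact (DilutedSpin.tensorConvex_kSatPenalty K).satRateLimit (by positivity)
      (inv_le_one_of_one_le₀ (one_le_pow₀ one_le_two))
      (DilutedSpin.PenaltyModel.extendable_of_exists_mark
        (DilutedSpin.exists_not_bad_kSatPenalty (by omega)))
      (fun _ _ G => DilutedSpin.groundState_kSat K G) rfl rfl rfl hc0.le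
  · intro K hK c hc0
    exact (DilutedSpin.tensorConvex_naeKSatPenalty (by omega)).satRateLimit (by positivity)
      (inv_le_one_of_one_le₀ (one_le_pow₀ one_le_two))
      (DilutedSpin.PenaltyModel.extendable_of_exists_mark
        (DilutedSpin.exists_not_bad_naeKSatPenalty hK))
      (fun _ _ G => DilutedSpin.groundState_naeKSat K G) rfl rfl rfl hc0.le
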